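/- Let $F$ be a distribution function on $\mathbb{R}$ that is rational-infinitely divisible, i.e. $F_1=F*F_2$ for some infinitely divisible distribution functions $F_1,F_2$. Let $F=c_dF_d+c_aF_a+c_sF_s$ be its Lebesgue decomposition, where $F_d$, $F_a$, $F_s$ are discrete, absolutely continuous and continuous singular distribution functions, $c_d>0$, $c_a\ge 0$, $c_s>0$, $c_d+c_a+c_s=1$, and let $f,f_d,f_a,f_s$ be the characteristic functions of $F,F_d,F_a,F_s$. Let $\mu_d=\inf_{t\in\mathbb{R}}|f_d(t)|$ and assume that the continuous singular part is dominated: $c_s<c_d\mu_d$ if $\mu_d>0$, and $c_s=0$ if $\mu_d=0$ (as $c_s>0$, this says $c_s<c_d\mu_d$). Let $\langle X\rangle$ be the additive group generated by the set $X$ of atoms of $F_d$. Suppose that $f$ is represented as $$f(t)=\exp\Bigl\{it\gamma_0+\sum_{u\in\langle X\rangle\setminus\{0\}}\lambda_u(e^{itu}-1)+\int_{\mathbb{R}\setminus\{0\}}(e^{itx}-1)\Bigl(v_a(x)+\operatorname{sgn}(x)\frac{\mathfrak{m}_a e^{-|x|}}{|x|}\Bigr)dx+\int_{\mathbb{R}\setminus\{0\}}(e^{itx}-1)\,dW(x)\Bigr\},\quad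 t\in\mathbb{R},$$ where $\gamma_0\in\langle X\rangle$; $\lambda_u\in\mathbb{R}$ and $\sum_u|\lambda_u|<\infty$; $v_a:\mathbb{R}\to\mathbb{R}$ is integrable, and identically $0$ if $c_a=0$; $W:\mathbb{R}\to\mathbb{R}$ is a continuous function of bounded total variation with $W(-\infty)=0$; and, with $R_a(t)=1+\frac{c_af_a(t)}{c_df_d(t)+c_sf_s(t)}$ and with $\operatorname{Arg}R_a$ denoting the continuous argument that is the principal one at $0$, the integer $\mathfrak{m}_a$ is $\frac1{2\pi}\bigl(\lim_{t\to\infty}\operatorname{Arg}R_a(t)-\lim_{t\to-\infty}\operatorname{Arg}R_a(t)\bigr)$. Here the part of the representation containing $v_a$ and $\mathfrak{m}_a$ is the one that belongs to $R_a$: $$(c_d+c_s)R_a(t)=\exp\Bigl\{\int_{\mathbb{R}\setminus\{0\}}(e^{itx}-1)\Bigl(v_a(x)+\operatorname{sgn}(x)\frac{\mathfrak{m}_a e^{-|x|}}{|x|}\Bigr)dx\Bigr\},\quad t\in\mathbb{R}$$ (for $c_a=0$ both sides are identically $1$). Suppose that for some integer $n_a\ge2$ the convolution power $F_s^{*(n_a-1)}$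 is purely continuous singular, but $F_s^{*n_a}=\alpha H_a+(1-\alpha)H_s$ with $\alpha\in(0,1]$, an absolutely continuous distribution function $H_a$ and a continuous singular distribution function $H_s$. If $\alpha\ge\frac{n_a}{n_a+1}\cdot\frac{c_s}{c_d}$, then $W$ is not purely continuous singular. In particular, $W$ is never purely continuous singular if $\alpha=1$. -/

import Mathlib

open MeasureTheory Filter Topology Set
open scoped ENNReal

namespace RationalInfDiv

/-! Distribution functions on the real line are represented by the corresponding probability
measures; `MeasureTheory.charFun` is the characteristic function and `∗` the convolution. -/

/-- The `n`-fold convolution power of a law on the real line. -/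
noncomputable def convPow (μ : Measure ℝ) : ℕ → Measure ℝ
  | 0 => Measure.dirac 0
  | n + 1 => Measure.conv (convPow μ n) μ

/-- A probability law which for every `n ≥ 1` is the `n`-fold convolution power of a law. -/
def IsInfinitelyDivisible (μ : Measure ℝ) : Prop :=
  IsProbabilityMeasure μ ∧
    ∀ n : ℕ, 1 ≤ n → ∃ ν : Measure ℝ, IsProbabilityMeasure ν ∧ μ = convPow ν n

/-- The class of rational-infinitely divisible laws: `F₁ = F ∗ F₂` with some infinitely divisible
`F₁` and `F₂`. -/
def IsRationalInfinitelyDivisible (F : Measure ℝ) : Prop :=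
  IsProbabilityMeasure F ∧
    ∃ F₁ F₂ : Measure ℝ, IsInfinitelyDivisible F₁ ∧ IsInfinitelyDivisible F₂ ∧
      F₁ = Measure.conv F F₂

/-- Discrete: concentrated on a countable set. -/
def IsDiscrete (μ : Measure ℝ) : Prop :=
  ∃ S : Set ℝ, S.Countable ∧ μ Sᶜ = 0

/-- Purely continuous singular: no atoms, and concentrated on a Lebesgue null set. -/
def IsContSingular (μ : Measure ℝ) : Prop :=
  (∀ x : ℝ, μ {x} = 0) ∧ μ ⟂ₘ volume

/-- `F = c_d F_d + c_a F_a + c_s F_s` with a discrete, an absolutely continuous and a continuous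
singular law and with non-negative weights of sum one. -/
structure IsLebesgueDecomposition (F : Measure ℝ) (cd ca cs : ℝ) (Fd Fa Fs : Measure ℝ) :
    Prop where
  prob_d : IsProbabilityMeasure Fd
  prob_a : IsProbabilityMeasure Fa
  prob_s : IsProbabilityMeasure Fs
  cd_nonneg : 0 ≤ cd
  ca_nonneg : 0 ≤ ca
  cs_nonneg : 0 ≤ cs
  sum_eq_one : cd + ca + cs = 1
  discrete : IsDiscrete Fd
  absCont : Fa ≪ volume
  contSingular : IsContSingular Fs
  eq : F = ENNReal.ofReal cd • Fd + ENNReal.ofReal ca • Fa + ENNReal.ofReal cs • Fs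

/-- `μ_d`, the infimum of the modulus of the characteristic function. -/
noncomputable def infNormCharFun (Fd : Measure ℝ) : ℝ :=
  ⨅ t : ℝ, ‖charFun Fd t‖

/-- The continuous singular part is dominated by the discrete part. -/
def HasDominatedSingularPart (cd cs : ℝ) (Fd : Measure ℝ) : Prop :=
  (0 < infNormCharFun Fd → cs < cd * infNormCharFun Fd) ∧ (infNormCharFun Fd = 0 → cs = 0)

/-- The additive group generated by the atoms of a law, i.e. the set of all finite integer linear
combinations of its atoms. -/
def atomGroup (Fd : Measure ℝ) : AddSubgroup ℝ :=
  AddSubgroup.closure {x : ℝ | Fd {x} ≠ 0}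

/-- `R_a(t) = 1 + c_a f_a(t) / (c_d f_d(t) + c_s f_s(t))`. -/
noncomputable def Ra (cd ca cs : ℝ) (Fd Fa Fs : Measure ℝ) (t : ℝ) : ℂ :=
  1 + (ca : ℂ) * charFun Fa t / ((cd : ℂ) * charFun Fd t + (cs : ℂ) * charFun Fs t)

/-- `θ` is the distinguished argument of `ψ`: the continuous choice of the argument which starts
at `0` from the principal value. -/
def IsDistinguishedArg (ψ : ℝ → ℂ) (θ : ℝ → ℝ) : Prop :=
  Continuous θ ∧ θ 0 = Complex.arg (ψ 0) ∧
    ∀ t : ℝ, ψ t = (‖ψ t‖ : ℂ) * Complex.exp (Complex.I * (θ t : ℂ))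

/-- The class of right-continuous functions of bounded total variation on the line which vanish
at `-∞`. -/
structure IsBV (W : ℝ → ℝ) : Prop where
  boundedVariation : BoundedVariationOn W univ
  rightCont : ∀ x : ℝ, ContinuousWithinAt W (Ici x) x
  limBot : Tendsto W atBot (𝓝 0)

/-- A function of the class `IsBV` is purely continuous singular if it is continuous and its
Lebesgue-Stieltjes measure is singular with respect to Lebesgue measure. -/
def IsContSingularFun (W : ℝ → ℝ) : Prop :=
  Continuous W ∧ ∃ hW : IsBV W, hW.boundedVariation.vectorMeasure.variation ⟂ₘ volume

/-- `i t γ₀ + ∑_u λ_u (e^{itu} - 1)`, the sum over the nonzero elements `u` of the group generated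
by the atoms. -/
noncomputable def discreteExponent (Fd : Measure ℝ) (γ₀ : ℝ)
    (lam : {u : ℝ // u ∈ atomGroup Fd ∧ u ≠ 0} → ℝ) (t : ℝ) : ℂ :=
  Complex.I * (t : ℂ) * (γ₀ : ℂ) +
    ∑' u : {u : ℝ // u ∈ atomGroup Fd ∧ u ≠ 0},
      (lam u : ℂ) * (Complex.exp (Complex.I * (t : ℂ) * ((u : ℝ) : ℂ)) - 1)

/-- `∫_{x ≠ 0} (e^{itx} - 1) (v(x) + sgn(x) m e^{-|x|} / |x|) dx`. -/
noncomputable def absContExponent (v : ℝ → ℝ) (m : ℤ) (t : ℝ) : ℂ :=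
  ∫ x in ({0}ᶜ : Set ℝ), (Complex.exp (Complex.I * (t : ℂ) * (x : ℂ)) - 1) *
    ((v x + Real.sign x * ((m : ℝ) * Real.exp (-|x|) / |x|) : ℝ) : ℂ)

/-- `∫_{x ≠ 0} (e^{itx} - 1) dW(x)`. -/
noncomputable def stieltjesExponent {W : ℝ → ℝ} (hW : IsBV W) (t : ℝ) : ℂ :=
  ∫ᵛ x in ({0}ᶜ : Set ℝ), (Complex.exp (Complex.I * (t : ℂ) * (x : ℂ)) - 1)
    ∂<•hW.boundedVariation.vectorMeasure

/-- The Lévy-type representation of the characteristic function of `F` with the parameters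
`γ₀, λ, v, m, W`.

If `c_a > 0`, then absolutely continuous parts can be moved freely between `v` and `W` without
changing the product of the last two factors; the field `factor_a` says which factor belongs to
`v` and `m`: the one that represents the function `R_a`, normalized to `1` at the origin
(`R_a(0) = 1 / (c_d + c_s)`). For `c_a = 0` this field holds by itself. -/
structure IsLevyRepresentation (F : Measure ℝ) (cd ca cs : ℝ) (Fd Fa Fs : Measure ℝ) (γ₀ : ℝ)
    (lam : {u : ℝ // u ∈ atomGroup Fd ∧ u ≠ 0} → ℝ) (v : ℝ → ℝ) (m : ℤ) (W : ℝ → ℝ) :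
    Prop where
  gamma_mem : γ₀ ∈ atomGroup Fd
  summable_lam : Summable fun u => |lam u|
  integrable_v : Integrable v volume
  v_eq_zero : ca = 0 → ∀ x, v x = 0
  index : ∃ (θ : ℝ → ℝ) (a b : ℝ), IsDistinguishedArg (Ra cd ca cs Fd Fa Fs) θ ∧
    Tendsto θ atTop (𝓝 a) ∧ Tendsto θ atBot (𝓝 b) ∧ (m : ℝ) = 1 / (2 * Real.pi) * (a - b)
  isBV : IsBV W
  continuous_W : Continuous W
  factor_a : ∀ t : ℝ,
    ((cd + cs : ℝ) : ℂ) * Ra cd ca cs Fd Fa Fs t = Complex.exp (absContExponent v m t)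
  repr : ∀ t : ℝ, charFun F t =
    Complex.exp (discreteExponent Fd γ₀ lam t + absContExponent v m t + stieltjesExponent isBV t)

end RationalInfDiv

/-!
Write `f_d`, `f_s` for the characteristic functions of `F_d`, `F_s` and put `r = c_s / c_d < 1`.
Suppose that `W` is purely continuous singular. Cancelling `R_a` in the representation of `f` gives
`c_d f_d + c_s f_s = E · exp (Ŵ)`, where `E` is the transform of a discrete measure, constants
included, and `Ŵ` is the transform of the signed measure `dW`, which has no atoms.

*The discrete factor.* Transforms of measures without atoms have quadratic mean zero (Wiener), and
so has `exp (Ŵ) - 1`; a transform of a discrete measure with quadratic mean zero vanishes. Hence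
`E = c_d f_d` (`discreteFactor_unique`), and `1 / f_d` is again the transform of a discrete
measure, because `E` is a monomial times an exponential. No Wiener-Lévy theorem is needed. What
remains is `exp (Ŵ) = 1 + r f_s / f_d`.

*The logarithm.* Let `G` be the discrete measure with transform `1 / f_d`, which is bounded by
`1 / μ_d`. Its spectral radius is at most `1 / μ_d` (`IsDiscreteTransform.exists_pow_bound`): after
truncation to finitely many atoms, the `k`-th power has only polynomially many frequencies, and
Bessel's inequality compares the sum of the moduli of its coefficients with the supremum of its
transform. As `r < μ_d`, the series `∑ₖ (-1)^(k+1) r^k / k · F_s^{*k} ∗ G^{*k}` converges in total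
variation, and by uniqueness of the continuous logarithm (`eq_log_of_isMeanNull`) its sum is `dW`.

*Masses.* Let `βₖ` be the mass of the absolutely continuous part of `F_s^{*k}`. The discrete measure
`G^{*k}` has total mass one, so convolving with it does not change that mass, and taking
absolutely continuous masses in the series gives `∑ₖ (-1)^(k+1) r^k / k · βₖ = 0`
(`hasSum_acMass_convPow`). But `βₖ` is nondecreasing with values in `[0, 1]`, vanishes for `k < n`,
and `βₙ ≥ α ≥ n r / (n + 1)`; an alternating series estimate shows that such a sum is not zero
(`not_hasSum_alternating`).
-/

namespace RationalInfDiv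

open ProbabilityTheory

/-! ### Transforms of real discrete measures -/

/-- `h` is the Fourier transform `∑ aᵢ e^{itxᵢ}` of a real discrete measure, written with
absolutely summable weights of total mass at most `C`. The frequencies need not be distinct, so
that `C` only bounds the total variation of the measure. -/
def IsDiscreteTransform (h : ℝ → ℂ) (C : ℝ) : Prop :=
  ∃ (ι : Type) (_ : Countable ι) (a x : ι → ℝ),
    Summable (fun i => |a i|) ∧ ∑' i, |a i| ≤ C ∧
      ∀ t : ℝ, HasSum (fun i => (a i : ℂ) * Complex.exp (Complex.I * (t : ℂ) * (x i : ℂ))) (h t)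

lemma norm_exp_I_mul_mul (t x : ℝ) :
    ‖Complex.exp (Complex.I * (t : ℂ) * (x : ℂ))‖ = 1 := by
  rw [show Complex.I * (t : ℂ) * (x : ℂ) = ((t * x : ℝ) : ℂ) * Complex.I by push_cast; ring]
  exact Complex.norm_exp_ofReal_mul_I _

lemma norm_ofReal_mul_exp_I (a t x : ℝ) :
    ‖(a : ℂ) * Complex.exp (Complex.I * (t : ℂ) * (x : ℂ))‖ = |a| := by
  rw [norm_mul, norm_exp_I_mul_mul, mul_one, Complex.norm_real, Real.norm_eq_abs]

lemma integrable_exp_I (μ : Measure ℝ) [IsFiniteMeasure μ] (t : ℝ) :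
    Integrable (fun x : ℝ => Complex.exp (t * x * Complex.I)) μ :=
  Integrable.of_bound (by fun_prop) 1 (.of_forall fun x => by
    rw [show (t : ℂ) * x * Complex.I = Complex.I * t * x by ring, norm_exp_I_mul_mul])

lemma charFun_add_measure (μ ν : Measure ℝ) [IsFiniteMeasure μ] [IsFiniteMeasure ν] (t : ℝ) :
    charFun (μ + ν) t = charFun μ t + charFun ν t := by
  simp_rw [charFun_apply_real]
  exact integral_add_measure (integrable_exp_I μ t) (integrable_exp_I ν t)

lemma charFun_ofReal_smul (μ : Measure ℝ) {c : ℝ} (hc : 0 ≤ c) (t : ℝ) :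
    charFun (ENNReal.ofReal c • μ) t = (c : ℂ) * charFun μ t := by
  simp_rw [charFun_apply_real]
  rw [integral_smul_measure, ENNReal.toReal_ofReal hc, Complex.real_smul]

namespace IsDiscreteTransform

variable {h g : ℝ → ℂ} {C D : ℝ}

lemma mono (hh : IsDiscreteTransform h C) (hCD : C ≤ D) : IsDiscreteTransform h D := by
  obtain ⟨ι, hι, a, x, ha, hC, hs⟩ := hh
  exact ⟨ι, hι, a, x, ha, hC.trans hCD, hs⟩

lemma nonneg (hh : IsDiscreteTransform h C) : 0 ≤ C := by
  obtain ⟨ι, hι, a, x, ha, hC, hs⟩ := hh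
  exact (tsum_nonneg fun i => abs_nonneg _).trans hC

lemma norm_le (hh : IsDiscreteTransform h C) (t : ℝ) : ‖h t‖ ≤ C := by
  obtain ⟨ι, hι, a, x, ha, hC, hs⟩ := hh
  refine le_trans ?_ hC
  rw [← (hs t).tsum_eq]
  have := norm_tsum_le_tsum_norm
    (f := fun i => (a i : ℂ) * Complex.exp (Complex.I * (t : ℂ) * (x i : ℂ)))
    (by simpa only [norm_ofReal_mul_exp_I] using ha)
  simpa only [norm_ofReal_mul_exp_I] using this

lemma continuous (hh : IsDiscreteTransform h C) : Continuous h := by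
  obtain ⟨ι, hι, a, x, ha, hC, hs⟩ := hh
  have : h = fun t : ℝ => ∑' i, (a i : ℂ) * Complex.exp (Complex.I * (t : ℂ) * (x i : ℂ)) :=
    funext fun t => (hs t).tsum_eq.symm
  rw [this]
  exact continuous_tsum (fun i => by fun_prop) ha fun i t => (norm_ofReal_mul_exp_I _ _ _).le

lemma monomial (a x : ℝ) :
    IsDiscreteTransform (fun t : ℝ => (a : ℂ) * Complex.exp (Complex.I * (t : ℂ) * (x : ℂ))) |a| :=
  ⟨Unit, inferInstance, fun _ => a, fun _ => x, Summable.of_finite, by simp,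
    fun t => by simp [hasSum_unique]⟩

lemma const (a : ℝ) : IsDiscreteTransform (fun _ => (a : ℂ)) |a| := by
  simpa using monomial a 0

lemma mul (hh : IsDiscreteTransform h C) (hg : IsDiscreteTransform g D) :
    IsDiscreteTransform (fun t => h t * g t) (C * D) := by
  have hC0 := hh.nonneg
  obtain ⟨ι, hι, a, x, ha, hC, hs⟩ := hh
  obtain ⟨κ, hκ, b, y, hb, hD, hs'⟩ := hg
  have hab : Summable fun p : ι × κ => |a p.1| * |b p.2| :=
    ha.mul_of_nonneg hb (fun _ => abs_nonneg _) (fun _ => abs_nonneg _)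
  refine ⟨ι × κ, inferInstance, fun p => a p.1 * b p.2, fun p => x p.1 + y p.2, ?_, ?_,
    fun t => ?_⟩
  · simpa only [abs_mul] using hab
  · simp only [abs_mul]
    rw [← ha.tsum_mul_tsum hb hab]
    exact mul_le_mul hC hD (tsum_nonneg fun i => abs_nonneg _) hC0
  · have hsum : Summable fun p : ι × κ =>
        ((a p.1 : ℂ) * Complex.exp (Complex.I * (t : ℂ) * (x p.1 : ℂ))) *
          ((b p.2 : ℂ) * Complex.exp (Complex.I * (t : ℂ) * (y p.2 : ℂ))) := by
      refine Summable.of_norm ?_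
      simpa only [norm_mul, norm_exp_I_mul_mul, mul_one, Complex.norm_real, Real.norm_eq_abs]
        using hab
    refine ((hs t).mul (hs' t) hsum).congr_fun ?_
    intro p
    push_cast
    rw [mul_add, Complex.exp_add]
    ring

lemma pow (hh : IsDiscreteTransform h C) (k : ℕ) :
    IsDiscreteTransform (fun t => h t ^ k) (C ^ k) := by
  induction k with
  | zero => simpa using const 1
  | succ k ih => simpa only [pow_succ] using ih.mul hh

lemma const_mul (a : ℝ) (hh : IsDiscreteTransform h C) :
    IsDiscreteTransform (fun t => (a : ℂ) * h t) (|a| * C) :=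
  (const a).mul hh

lemma hasSum {κ : Type} [Countable κ] {H : κ → ℝ → ℂ} {B : κ → ℝ} (hB : Summable B)
    (hH : ∀ k, IsDiscreteTransform (H k) (B k)) (hh : ∀ t, HasSum (fun k => H k t) (h t)) :
    IsDiscreteTransform h (∑' k, B k) := by
  choose ι hι a x ha hC hs using hH
  have hsig : Summable fun p : Σ k, ι k => |a p.1 p.2| :=
    (summable_sigma_of_nonneg fun _ => abs_nonneg _).2
      ⟨ha, hB.of_nonneg_of_le (fun k => tsum_nonneg fun i => abs_nonneg _) hC⟩
  refine ⟨Σ k, ι k, inferInstance, fun p => a p.1 p.2, fun p => x p.1 p.2, hsig, ?_, fun t => ?_⟩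
  · rw [hsig.tsum_sigma' ha]
    exact Summable.tsum_le_tsum hC
      (hB.of_nonneg_of_le (fun k => tsum_nonneg fun i => abs_nonneg _) hC) hB
  · have hsum : Summable fun p : Σ k, ι k =>
        (a p.1 p.2 : ℂ) * Complex.exp (Complex.I * (t : ℂ) * (x p.1 p.2 : ℂ)) :=
      Summable.of_norm (by simpa only [norm_ofReal_mul_exp_I] using hsig)
    have : HasSum (fun k => H k t) _ := hsum.hasSum.sigma fun k => hs k t
    rw [(hh t).unique this]
    exact hsum.hasSum

lemma sum {κ : Type} {s : Finset κ} {H : κ → ℝ → ℂ} {B : κ → ℝ}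
    (hH : ∀ k, IsDiscreteTransform (H k) (B k)) :
    IsDiscreteTransform (fun t => ∑ k ∈ s, H k t) (∑ k ∈ s, B k) := by
  rw [← s.sum_coe_sort B, ← tsum_fintype (L := .unconditional _)]
  refine hasSum (κ := s) (Summable.of_finite) (fun k => hH k) fun t => ?_
  rw [← s.sum_coe_sort]
  exact hasSum_fintype _

lemma add (hh : IsDiscreteTransform h C) (hg : IsDiscreteTransform g D) :
    IsDiscreteTransform (fun t => h t + g t) (C + D) := by
  have := sum (s := Finset.univ) (H := fun b : Bool => if b then h else g)
    (B := fun b : Bool => if b then C else D) (by rintro (_ | _) <;> simpa)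
  simpa using this

lemma exp (hh : IsDiscreteTransform h C) :
    IsDiscreteTransform (fun t => Complex.exp (h t)) (Real.exp C) := by
  have h1 : Real.exp C = ∑' k : ℕ, |((k.factorial : ℝ))⁻¹| * C ^ k := by
    rw [Real.exp_eq_exp_ℝ, NormedSpace.exp_eq_tsum_div]
    refine tsum_congr fun k => ?_
    rw [abs_of_nonneg (by positivity)]
    ring
  rw [h1]
  refine hasSum (κ := ℕ) ?_ (fun k => (hh.pow k).const_mul ((k.factorial : ℝ))⁻¹) fun t => ?_
  · refine (Real.summable_pow_div_factorial C).congr fun k => ?_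
    rw [abs_of_nonneg (by positivity)]
    ring
  · have := NormedSpace.expSeries_div_hasSum_exp (h t)
    rw [← Complex.exp_eq_exp_ℂ] at this
    refine this.congr_fun fun k => ?_
    push_cast
    ring

end IsDiscreteTransform

/-- The characteristic function of a discrete law is the sum over its atoms. -/
lemma isDiscreteTransform_charFun {μ : Measure ℝ} [IsFiniteMeasure μ] (hμ : IsDiscrete μ) :
    IsDiscreteTransform (charFun μ) (μ.real univ) := by
  obtain ⟨S, hS, hS0⟩ := hμ
  have hrestr : μ.restrict S = μ := Measure.restrict_eq_self_of_ae_mem hS0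
  have := hS.to_subtype
  have key : ∀ {E : Type} [NormedAddCommGroup E] [NormedSpace ℝ E] [CompleteSpace E] (f : ℝ → E),
      Integrable f μ → HasSum (fun i : S => μ.real {(i : ℝ)} • f i) (∫ y, f y ∂μ) := by
    intro E _ _ _ f hf
    have h2 := hasSum_integral_iUnion (μ := μ) (f := f) (s := fun i : S => {(i : ℝ)})
      (fun i => measurableSet_singleton _)
      (fun i j hij => by simpa using fun h => hij (Subtype.ext h)) hf.integrableOn
    have h3 : (⋃ i : S, {(i : ℝ)}) = S := by ext; simp
    rw [h3, hrestr] at h2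
    simpa [measureReal_def] using h2
  have h1 := key (fun _ => (1 : ℝ)) (integrable_const _)
  simp only [smul_eq_mul, mul_one, integral_const] at h1
  refine ⟨S, inferInstance, fun i => μ.real {(i : ℝ)}, fun i => i, ?_, ?_, fun t => ?_⟩
  · simpa only [abs_of_nonneg measureReal_nonneg] using h1.summable
  · simpa only [abs_of_nonneg measureReal_nonneg] using h1.tsum_eq.le
  · rw [charFun_apply_real]
    have h4 := key _ (integrable_exp_I μ t)
    refine h4.congr_fun fun i => ?_
    rw [Complex.real_smul, show (t : ℂ) * (i : ℝ) * Complex.I = Complex.I * t * (i : ℝ) by ring]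

/-! ### Gaussian means -/

/-- Averaging the exponential `e^{itx}` over the centred Gaussian law with variance `n`. -/
lemma integral_exp_gaussianReal (n : ℕ) (x : ℝ) :
    ∫ t, Complex.exp (Complex.I * (t : ℂ) * (x : ℂ)) ∂gaussianReal 0 n =
      ((Real.exp (-(n * x ^ 2 / 2)) : ℝ) : ℂ) := by
  have h := charFun_gaussianReal (μ := 0) (v := (n : NNReal)) x
  rw [charFun_apply_real] at h
  rw [show (fun t : ℝ => Complex.exp (Complex.I * (t : ℂ) * (x : ℂ))) =
    fun t : ℝ => Complex.exp ((x : ℂ) * (t : ℂ) * Complex.I) by ext t; ring_nf, h]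
  push_cast
  ring_nf

lemma tendsto_gaussian_mean_exp (x : ℝ) :
    Tendsto (fun n : ℕ => Real.exp (-(n * x ^ 2 / 2))) atTop (𝓝 (if x = 0 then 1 else 0)) := by
  split_ifs with hx
  · simp [hx]
  · have : 0 < x ^ 2 / 2 := by positivity
    refine Real.tendsto_exp_neg_atTop_nhds_zero.comp ?_
    refine (tendsto_natCast_atTop_atTop.atTop_mul_const this).congr fun n => ?_
    ring

/-- `h` is bounded, continuous and has quadratic mean zero. Means are taken over centred Gaussian
laws of growing variance, which makes the mean of an exponential explicit. -/
structure IsMeanNull (h : ℝ → ℂ) : Prop where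
  continuous : Continuous h
  bounded : ∃ B, ∀ t, ‖h t‖ ≤ B
  tendsto : Tendsto (fun n : ℕ => ∫ t, ‖h t‖ ^ 2 ∂gaussianReal 0 n) atTop (𝓝 0)

lemma integrable_of_bounded {E : Type*} [NormedAddCommGroup E] [SecondCountableTopology E]
    {μ : Measure ℝ} [IsFiniteMeasure μ] {h : ℝ → E}
    (hc : Continuous h) {B : ℝ} (hB : ∀ t, ‖h t‖ ≤ B) : Integrable h μ :=
  Integrable.of_bound hc.aestronglyMeasurable B (.of_forall hB)

lemma integrable_normSq_of_bounded {μ : Measure ℝ} [IsFiniteMeasure μ] {h : ℝ → ℂ}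
    (hc : Continuous h) {B : ℝ} (hB : ∀ t, ‖h t‖ ≤ B) : Integrable (fun t => ‖h t‖ ^ 2) μ := by
  refine integrable_of_bounded (B := B ^ 2) (by fun_prop) fun t => ?_
  rw [Real.norm_of_nonneg (by positivity)]
  exact pow_le_pow_left₀ (norm_nonneg _) (hB t) 2

namespace IsMeanNull

variable {h g : ℝ → ℂ}

/-- A continuous function dominated by a function with quadratic mean zero has this property
too. -/
lemma of_norm_le (hh : IsMeanNull h) (hg : Continuous g) (K : ℝ)
    (hK : ∀ t, ‖g t‖ ≤ K * ‖h t‖) : IsMeanNull g := by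
  obtain ⟨B, hB⟩ := hh.bounded
  have hgB : ∀ t, ‖g t‖ ≤ |K| * B := fun t =>
    (hK t).trans (mul_le_mul (le_abs_self K) (hB t) (norm_nonneg _) (abs_nonneg _))
  refine ⟨hg, ⟨_, hgB⟩, ?_⟩
  have hlim : Tendsto (fun n : ℕ => K ^ 2 * ∫ t, ‖h t‖ ^ 2 ∂gaussianReal 0 n) atTop (𝓝 0) := by
    simpa using hh.tendsto.const_mul (K ^ 2)
  refine squeeze_zero (fun n => integral_nonneg fun t => by positivity) (fun n => ?_) hlim
  rw [← integral_const_mul]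
  refine integral_mono (integrable_normSq_of_bounded hg hgB)
    ((integrable_normSq_of_bounded hh.continuous hB).const_mul _) fun t => ?_
  simp only
  rw [← mul_pow]
  exact pow_le_pow_left₀ (norm_nonneg _) (hK t) 2

lemma add (hh : IsMeanNull h) (hg : IsMeanNull g) : IsMeanNull fun t => h t + g t := by
  obtain ⟨B, hB⟩ := hh.bounded
  obtain ⟨D, hD⟩ := hg.bounded
  have hBD : ∀ t, ‖h t + g t‖ ≤ B + D := fun t =>
    (norm_add_le _ _).trans (add_le_add (hB t) (hD t))
  have hc : Continuous fun t => h t + g t := hh.continuous.add hg.continuous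
  refine ⟨hc, ⟨_, hBD⟩, ?_⟩
  have hlim : Tendsto (fun n : ℕ => 2 * (∫ t, ‖h t‖ ^ 2 ∂gaussianReal 0 n) +
      2 * ∫ t, ‖g t‖ ^ 2 ∂gaussianReal 0 n) atTop (𝓝 0) := by
    simpa using (hh.tendsto.const_mul 2).add (hg.tendsto.const_mul 2)
  refine squeeze_zero (fun n => integral_nonneg fun t => by positivity) (fun n => ?_) hlim
  have i1 := (integrable_normSq_of_bounded (μ := gaussianReal 0 n) hh.continuous hB).const_mul 2
  have i2 := (integrable_normSq_of_bounded (μ := gaussianReal 0 n) hg.continuous hD).const_mul 2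
  rw [← integral_const_mul, ← integral_const_mul, ← integral_add i1 i2]
  refine integral_mono (integrable_normSq_of_bounded hc hBD) (i1.add i2) fun t => ?_
  have := pow_le_pow_left₀ (norm_nonneg _) (norm_add_le (h t) (g t)) 2
  simp only
  nlinarith [sq_nonneg (‖h t‖ - ‖g t‖)]

lemma const_mul (hh : IsMeanNull h) (c : ℂ) : IsMeanNull fun t => c * h t :=
  hh.of_norm_le (hh.continuous.const_mul c) ‖c‖ fun _ => (norm_mul _ _).le

lemma sub (hh : IsMeanNull h) (hg : IsMeanNull g) : IsMeanNull fun t => h t - g t := by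
  simpa [sub_eq_add_neg] using hh.add (hg.const_mul (-1))

lemma eq_zero_of_const {c : ℂ} (hc : IsMeanNull fun _ => c) : c = 0 := by
  have := hc.tendsto
  simpa using this

/-- The mean of `h` against any character vanishes. -/
lemma tendsto_integral_mul_exp (hh : IsMeanNull h) (x : ℝ) :
    Tendsto (fun n : ℕ => ∫ t, h t * Complex.exp (Complex.I * (t : ℂ) * (x : ℂ)) ∂gaussianReal 0 n)
      atTop (𝓝 0) := by
  obtain ⟨B, hB⟩ := hh.bounded
  rw [Metric.tendsto_atTop]
  intro ε hε
  obtain ⟨N, hN⟩ := Metric.tendsto_atTop.1 hh.tendsto (ε / 4 * (ε / 4)) (by positivity)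
  refine ⟨N, fun n hn => ?_⟩
  have h1 := hN n hn
  rw [Real.dist_0_eq_abs] at h1
  have h2 := (le_abs_self _).trans_lt h1
  rw [dist_zero_right]
  have i1 := integrable_normSq_of_bounded (μ := gaussianReal 0 n) hh.continuous hB
  calc ‖∫ t, h t * Complex.exp (Complex.I * (t : ℂ) * (x : ℂ)) ∂gaussianReal 0 n‖
      ≤ ∫ t, ‖h t * Complex.exp (Complex.I * (t : ℂ) * (x : ℂ))‖ ∂gaussianReal 0 n :=
        norm_integral_le_integral_norm _
    _ ≤ ∫ t, (ε / 4 + (ε / 4)⁻¹ * ‖h t‖ ^ 2) ∂gaussianReal 0 n := by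
        refine integral_mono ?_ ((integrable_const _).add (i1.const_mul _)) fun t => ?_
        · refine (integrable_of_bounded (B := B) (h := fun t => h t *
            Complex.exp (Complex.I * (t : ℂ) * (x : ℂ))) ?_ fun t => ?_).norm
          · exact hh.continuous.mul (by fun_prop)
          · rw [norm_mul, norm_exp_I_mul_mul, mul_one]
            exact hB t
        · simp only
          rw [norm_mul, norm_exp_I_mul_mul, mul_one]
          have h3 : 0 < ε / 4 := by positivity
          have h4 : ε / 4 * (ε / 4)⁻¹ = 1 := mul_inv_cancel₀ h3.ne'
          have h5 : 0 < (ε / 4)⁻¹ := by positivity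
          nlinarith [mul_nonneg h5.le (sq_nonneg (‖h t‖ - ε / 4)), norm_nonneg (h t)]
    _ = ε / 4 + (ε / 4)⁻¹ * ∫ t, ‖h t‖ ^ 2 ∂gaussianReal 0 n := by
        rw [integral_add (integrable_const _) (i1.const_mul _), integral_const_mul]
        simp
    _ ≤ ε / 4 + (ε / 4)⁻¹ * (ε / 4 * (ε / 4)) := by gcongr
    _ < ε := by field_simp; linarith

end IsMeanNull

/-- The Gaussian means of a characteristic function converge to the mass of the origin. -/
lemma tendsto_integral_charFun (ν : Measure ℝ) [IsFiniteMeasure ν] :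
    Tendsto (fun n : ℕ => ∫ t, charFun ν t ∂gaussianReal 0 n) atTop (𝓝 (ν.real {0} : ℂ)) := by
  have h1 : ∀ n : ℕ, ∫ t, charFun ν t ∂gaussianReal 0 n =
      ∫ x, ((Real.exp (-(n * x ^ 2 / 2)) : ℝ) : ℂ) ∂ν := by
    intro n
    simp_rw [charFun_apply_real]
    rw [integral_integral_swap]
    · refine integral_congr_ae (.of_forall fun x => ?_)
      simp only
      rw [← integral_exp_gaussianReal]
      congr with t
      ring_nf
    · refine Integrable.of_bound (by fun_prop) 1 (.of_forall fun p => ?_)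
      simp only [Function.uncurry]
      rw [show (p.1 : ℂ) * p.2 * Complex.I = Complex.I * p.1 * p.2 by ring, norm_exp_I_mul_mul]
  simp_rw [h1]
  have h2 : (ν.real {0} : ℂ) = ∫ x, (if x = 0 then (1 : ℂ) else 0) ∂ν := by
    rw [show (fun x : ℝ => if x = 0 then (1 : ℂ) else 0) = ({0} : Set ℝ).indicator 1 by
      ext x; simp [Set.indicator]]
    rw [integral_indicator (measurableSet_singleton _)]
    simp [measureReal_def]
  rw [h2]
  refine tendsto_integral_of_dominated_convergence (fun _ => 1) (fun n => by fun_prop)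
    (integrable_const _) (fun n => .of_forall fun x => ?_) (.of_forall fun x => ?_)
  · rw [Complex.norm_real, Real.norm_of_nonneg (Real.exp_pos _).le]
    exact Real.exp_le_one_iff.2 (by simpa using by positivity)
  · have := (Complex.continuous_ofReal.tendsto _).comp (tendsto_gaussian_mean_exp x)
    split_ifs at this ⊢ with hx
    · simpa only [Function.comp_def, Complex.ofReal_one] using this
    · simpa only [Function.comp_def, Complex.ofReal_zero] using this

/-- **Wiener's lemma**, in the case without atoms. -/
lemma isMeanNull_charFun {μ : Measure ℝ} [IsFiniteMeasure μ] (hμ : ∀ x, μ {x} = 0) :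
    IsMeanNull (charFun μ) := by
  have hcont : Continuous (charFun μ) := continuous_charFun
  refine ⟨hcont, ⟨_, fun t => norm_charFun_le t⟩, ?_⟩
  have : IsFiniteMeasure (μ.map fun x => -1 * x) := by infer_instance
  have h0 : (μ ∗ (μ.map fun x => -1 * x)) {0} = 0 := by
    rw [← lintegral_indicator_one (measurableSet_singleton _),
      Measure.lintegral_conv (measurable_one.indicator (measurableSet_singleton _))]
    refine (lintegral_congr fun x => ?_).trans lintegral_zero
    have hm : Measurable fun y : ℝ => ({0} : Set ℝ).indicator (1 : ℝ → ℝ≥0∞) (x + y) :=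
      (measurable_one.indicator (measurableSet_singleton _)).comp (measurable_const_add x)
    rw [lintegral_map hm (by fun_prop)]
    have : (fun a : ℝ => ({0} : Set ℝ).indicator (1 : ℝ → ℝ≥0∞) (x + -1 * a)) =
        ({x} : Set ℝ).indicator 1 := by
      ext a
      simp only [Set.indicator, mem_singleton_iff]
      congr 1
      exact propext ⟨fun h => by linarith, fun h => by linarith⟩
    rw [this, lintegral_indicator_one (measurableSet_singleton _), hμ]
  have h1 := tendsto_integral_charFun (μ ∗ (μ.map fun x => -1 * x))
  rw [measureReal_def, h0] at h1
  have h2 := (Complex.continuous_re.tendsto _).comp h1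
  simp only [ENNReal.toReal_zero, Complex.ofReal_zero, Complex.zero_re] at h2
  refine h2.congr fun n => ?_
  have h3 : ∀ t, charFun (μ ∗ (μ.map fun x => -1 * x)) t = ((‖charFun μ t‖ ^ 2 : ℝ) : ℂ) := by
    intro t
    rw [charFun_conv, charFun_map_mul, show (-1 : ℝ) * t = -t by ring, charFun_neg,
      Complex.mul_conj, Complex.normSq_eq_norm_sq]
  simp only [Function.comp, h3, integral_complex_ofReal, Complex.ofReal_re]

/-- A transform of a discrete measure with quadratic mean zero vanishes: by taking means against
the characters, all masses of the measure are zero. -/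
lemma IsDiscreteTransform.eq_zero_of_isMeanNull {h : ℝ → ℂ} {C : ℝ}
    (hh : IsDiscreteTransform h C) (hn : IsMeanNull h) (t : ℝ) : h t = 0 := by
  obtain ⟨ι, hι, a, x, ha, hC, hs⟩ := hh
  have hmean : ∀ (y : ℝ) (n : ℕ),
      ∫ t, h t * Complex.exp (Complex.I * (t : ℂ) * ((-y : ℝ) : ℂ)) ∂gaussianReal 0 n =
        ∑' i, ((a i * Real.exp (-(n * (x i - y) ^ 2 / 2)) : ℝ) : ℂ) := by
    intro y n
    have h1 : ∀ t : ℝ, h t * Complex.exp (Complex.I * (t : ℂ) * ((-y : ℝ) : ℂ)) =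
        ∑' i, (a i : ℂ) * Complex.exp (Complex.I * (t : ℂ) * ((x i - y : ℝ) : ℂ)) := by
      intro t
      rw [← (hs t).tsum_eq, ← tsum_mul_right]
      refine tsum_congr fun i => ?_
      rw [mul_assoc, ← Complex.exp_add]
      push_cast
      ring_nf
    simp_rw [h1]
    rw [← integral_tsum_of_summable_integral_norm]
    · refine tsum_congr fun i => ?_
      rw [integral_const_mul, integral_exp_gaussianReal]
      push_cast
      rfl
    · intro i
      exact integrable_of_bounded (by fun_prop) fun t => (norm_ofReal_mul_exp_I _ _ _).le
    · simp only [norm_ofReal_mul_exp_I]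
      simpa using ha
  have hfib : ∀ y, HasSum (fun i : {i // x i = y} => (a i : ℂ)) 0 := by
    intro y
    have hlim := tendsto_tsum_of_dominated_convergence (𝓕 := atTop)
      (f := fun (n : ℕ) i => ((a i * Real.exp (-(n * (x i - y) ^ 2 / 2)) : ℝ) : ℂ))
      (g := fun i => ((a i * (if x i - y = 0 then 1 else 0) : ℝ) : ℂ)) ha
      (fun i => (Complex.continuous_ofReal.tendsto _).comp
        ((tendsto_gaussian_mean_exp (x i - y)).const_mul (a i)))
      (.of_forall fun n i => by
        rw [Complex.norm_real, norm_mul, Real.norm_eq_abs]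
        refine mul_le_of_le_one_right (abs_nonneg _) ?_
        rw [Real.norm_of_nonneg (Real.exp_pos _).le]
        exact Real.exp_le_one_iff.2 (by simpa using by positivity))
    simp_rw [← hmean y] at hlim
    have h0 := tendsto_nhds_unique hlim (hn.tendsto_integral_mul_exp (-y))
    have hsumm : Summable fun i => ((a i * (if x i - y = 0 then 1 else 0) : ℝ) : ℂ) := by
      refine Summable.of_norm_bounded ha fun i => ?_
      rw [Complex.norm_real, norm_mul, Real.norm_eq_abs]
      refine mul_le_of_le_one_right (abs_nonneg _) ?_
      split_ifs <;> simp
    have h3 := hsumm.hasSum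
    rw [h0] at h3
    have h4 : (fun i => ((a i * (if x i - y = 0 then 1 else 0) : ℝ) : ℂ)) =
        ({i | x i = y} : Set ι).indicator fun i => (a i : ℂ) := by
      ext i
      simp only [Set.indicator, mem_ofPred_eq, sub_eq_zero]
      split_ifs <;> simp
    rw [h4] at h3
    exact hasSum_subtype_iff_indicator.2 h3
  have h5 : HasSum ((fun i => (a i : ℂ) * Complex.exp (Complex.I * (t : ℂ) * (x i : ℂ))) ∘
      Equiv.sigmaFiberEquiv x) (h t) := (Equiv.hasSum_iff _).2 (hs t)
  have h6 : ∀ y, HasSum (fun i : {i // x i = y} => ((fun i => (a i : ℂ) *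
      Complex.exp (Complex.I * (t : ℂ) * (x i : ℂ))) ∘ Equiv.sigmaFiberEquiv x) ⟨y, i⟩) 0 := by
    intro y
    have := (hfib y).mul_right (Complex.exp (Complex.I * (t : ℂ) * (y : ℂ)))
    rw [zero_mul] at this
    refine this.congr_fun fun i => ?_
    simp [Equiv.sigmaFiberEquiv, i.2]
  exact (h5.sigma h6).unique hasSum_zero

/-- **Bessel's inequality** for a trigonometric polynomial with distinct frequencies. -/
lemma sum_sq_le_of_norm_le {s : Finset ℝ} {c : ℝ → ℝ} {M : ℝ}
    (hM : ∀ t : ℝ, ‖∑ u ∈ s, (c u : ℂ) * Complex.exp (Complex.I * (t : ℂ) * (u : ℂ))‖ ≤ M) :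
    ∑ u ∈ s, c u ^ 2 ≤ M ^ 2 := by
  set P : ℝ → ℂ := fun t => ∑ u ∈ s, (c u : ℂ) * Complex.exp (Complex.I * (t : ℂ) * (u : ℂ))
    with hP
  have hPc : Continuous P := by fun_prop
  have h1 : ∀ t, ((‖P t‖ ^ 2 : ℝ) : ℂ) = ∑ u ∈ s, ∑ v ∈ s,
      ((c u * c v : ℝ) : ℂ) * Complex.exp (Complex.I * (t : ℂ) * ((u - v : ℝ) : ℂ)) := by
    intro t
    rw [← Complex.normSq_eq_norm_sq, ← Complex.mul_conj, hP]
    simp only [map_sum, Finset.sum_mul_sum]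
    refine Finset.sum_congr rfl fun u _ => Finset.sum_congr rfl fun v _ => ?_
    rw [map_mul, ← Complex.exp_conj]
    simp only [map_mul, Complex.conj_I, Complex.conj_ofReal]
    rw [mul_mul_mul_comm, ← Complex.exp_add]
    push_cast
    ring_nf
  have h2 : ∀ n : ℕ, ∫ t, ‖P t‖ ^ 2 ∂gaussianReal 0 n =
      ∑ u ∈ s, ∑ v ∈ s, c u * c v * Real.exp (-(n * (u - v) ^ 2 / 2)) := by
    intro n
    have hint : ∀ u v : ℝ, Integrable (fun t : ℝ => ((c u * c v : ℝ) : ℂ) *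
        Complex.exp (Complex.I * (t : ℂ) * ((u - v : ℝ) : ℂ))) (gaussianReal 0 n) :=
      fun u v => integrable_of_bounded (by fun_prop) fun t => (norm_ofReal_mul_exp_I _ _ _).le
    apply Complex.ofReal_injective
    rw [← integral_complex_ofReal]
    simp_rw [h1]
    rw [integral_finsetSum _ fun u _ => integrable_finsetSum _ fun v _ => hint u v]
    push_cast
    refine Finset.sum_congr rfl fun u _ => ?_
    rw [integral_finsetSum _ fun v _ => by simpa using hint u v]
    refine Finset.sum_congr rfl fun v _ => ?_
    have := integral_exp_gaussianReal n (u - v)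
    push_cast at this
    rw [integral_const_mul, this]
  have h3 : Tendsto (fun n : ℕ => ∫ t, ‖P t‖ ^ 2 ∂gaussianReal 0 n) atTop
      (𝓝 (∑ u ∈ s, c u ^ 2)) := by
    simp_rw [h2]
    have : ∑ u ∈ s, c u ^ 2 = ∑ u ∈ s, ∑ v ∈ s, c u * c v * (if u - v = 0 then 1 else 0) := by
      refine Finset.sum_congr rfl fun u hu => ?_
      simp [sub_eq_zero, hu, sq]
    rw [this]
    exact tendsto_finsetSum _ fun u _ => tendsto_finsetSum _ fun v _ =>
      (tendsto_gaussian_mean_exp (u - v)).const_mul _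
  refine le_of_tendsto h3 (.of_forall fun n => ?_)
  calc ∫ t, ‖P t‖ ^ 2 ∂gaussianReal 0 n ≤ ∫ t, M ^ 2 ∂gaussianReal 0 n :=
        integral_mono (integrable_normSq_of_bounded hPc hM) (integrable_const _)
          fun t => pow_le_pow_left₀ (norm_nonneg _) (hM t) 2
    _ = M ^ 2 := by simp

/-! ### The spectral radius of a discrete measure -/

/-- A trigonometric polynomial with at most `N` terms and values of modulus at most `M` is the
transform of a measure of total variation at most `√N M`. The frequencies may coincide. -/
lemma isDiscreteTransform_of_card_le {κ : Type} {s : Finset κ} {c w : κ → ℝ} {M : ℝ} {N : ℕ}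
    (hN : s.card ≤ N)
    (hM : ∀ t : ℝ, ‖∑ k ∈ s, (c k : ℂ) * Complex.exp (Complex.I * (t : ℂ) * (w k : ℂ))‖ ≤ M) :
    IsDiscreteTransform
      (fun t => ∑ k ∈ s, (c k : ℂ) * Complex.exp (Complex.I * (t : ℂ) * (w k : ℂ)))
      (√N * M) := by
  classical
  have hM0 : 0 ≤ M := (norm_nonneg _).trans (hM 0)
  set d : ℝ → ℝ := fun v => ∑ k ∈ s with w k = v, c k with hd
  have hP : ∀ t : ℝ, ∑ k ∈ s, (c k : ℂ) * Complex.exp (Complex.I * (t : ℂ) * (w k : ℂ)) =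
      ∑ v ∈ s.image w, (d v : ℂ) * Complex.exp (Complex.I * (t : ℂ) * (v : ℂ)) := by
    intro t
    rw [← Finset.sum_fiberwise_of_maps_to (fun k hk => Finset.mem_image_of_mem w hk)]
    refine Finset.sum_congr rfl fun v _ => ?_
    rw [hd]
    push_cast
    rw [Finset.sum_mul]
    refine Finset.sum_congr rfl fun k hk => ?_
    rw [(Finset.mem_filter.1 hk).2]
  simp_rw [hP] at hM ⊢
  have h1 := sum_sq_le_of_norm_le hM
  refine (IsDiscreteTransform.sum fun v => IsDiscreteTransform.monomial (d v) v).mono ?_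
  have h2 := Finset.sum_mul_sq_le_sq_mul_sq (s.image w) (fun _ => 1) fun v => |d v|
  simp only [one_mul, one_pow, Finset.sum_const, nsmul_eq_mul, mul_one, sq_abs] at h2
  have h3 : ((s.image w).card : ℝ) ≤ N := by exact_mod_cast Finset.card_image_le.trans hN
  refine abs_le_of_sq_le_sq' ?_ (by positivity) |>.2
  rw [mul_pow, Real.sq_sqrt (by positivity)]
  exact h2.trans (mul_le_mul h3 h1 (Finset.sum_nonneg fun _ _ => sq_nonneg _) (by positivity))

/-- The `k`-th power of a trigonometric polynomial with `m` terms has at most `(k + 1) ^ m`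
frequencies, hence its total variation is not much larger than the `k`-th power of its supremum. -/
lemma isDiscreteTransform_trigPoly_pow {ι : Type} (s : Finset ι) {a x : ι → ℝ} {M : ℝ}
    (hM : ∀ t : ℝ, ‖∑ i ∈ s, (a i : ℂ) * Complex.exp (Complex.I * (t : ℂ) * (x i : ℂ))‖ ≤ M)
    (k : ℕ) :
    IsDiscreteTransform
      (fun t => (∑ i ∈ s, (a i : ℂ) * Complex.exp (Complex.I * (t : ℂ) * (x i : ℂ))) ^ k)
      (((k : ℝ) + 1) ^ s.card * M ^ k) := by
  classical
  have hM0 : 0 ≤ M := (norm_nonneg _).trans (hM 0)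
  have hpow : ∀ t : ℝ,
      (∑ i ∈ s, (a i : ℂ) * Complex.exp (Complex.I * (t : ℂ) * (x i : ℂ))) ^ k =
      ∑ n ∈ s.piAntidiag k, ((Nat.multinomial s n * ∏ i ∈ s, a i ^ n i : ℝ) : ℂ) *
        Complex.exp (Complex.I * (t : ℂ) * ((∑ i ∈ s, n i * x i : ℝ) : ℂ)) := by
    intro t
    rw [Finset.sum_pow_eq_sum_piAntidiag]
    refine Finset.sum_congr rfl fun n _ => ?_
    push_cast
    rw [Finset.mul_sum, Complex.exp_sum, mul_assoc, ← Finset.prod_mul_distrib]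
    congr 1
    refine Finset.prod_congr rfl fun i _ => ?_
    rw [mul_pow, ← Complex.exp_nat_mul]
    ring_nf
  have hcard : (s.piAntidiag k).card ≤ (k + 1) ^ s.card := by
    have : (s.piAntidiag k).card ≤ (Fintype.piFinset fun _ : s => Finset.range (k + 1)).card := by
      refine Finset.card_le_card_of_injOn (fun n i => n i) (fun n hn => ?_) fun n hn n' hn' h => ?_
      · rw [Finset.mem_coe, Finset.mem_piAntidiag] at hn
        simp only [Finset.mem_coe, Fintype.mem_piFinset, Finset.mem_range]
        intro i
        have := Finset.single_le_sum (f := n) (fun _ _ => Nat.zero_le _) i.2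
        exact Nat.lt_succ_of_le (this.trans hn.1.le)
      · rw [Finset.mem_coe, Finset.mem_piAntidiag] at hn hn'
        ext i
        by_cases hi : i ∈ s
        · exact congrFun h ⟨i, hi⟩
        · rw [not_imp_comm.1 (hn.2 i) hi, not_imp_comm.1 (hn'.2 i) hi]
    simpa using this
  have hM' : ∀ t : ℝ, ‖∑ n ∈ s.piAntidiag k,
      ((Nat.multinomial s n * ∏ i ∈ s, a i ^ n i : ℝ) : ℂ) *
        Complex.exp (Complex.I * (t : ℂ) * ((∑ i ∈ s, n i * x i : ℝ) : ℂ))‖ ≤ M ^ k := by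
    intro t
    rw [← hpow, norm_pow]
    exact pow_le_pow_left₀ (norm_nonneg _) (hM t) k
  simp_rw [hpow]
  refine (isDiscreteTransform_of_card_le hcard hM').mono ?_
  have h1 : (1 : ℝ) ≤ ((k : ℝ) + 1) ^ s.card := one_le_pow₀ (by simp)
  push_cast
  refine mul_le_mul_of_nonneg_right ?_ (by positivity)
  rw [Real.sqrt_le_left (by positivity)]
  exact le_self_pow₀ h1 two_ne_zero

/-- **Spectral radius formula** for discrete measures: up to a polynomial factor, the total
variation of the `k`-th convolution power grows no faster than `(M + δ) ^ k`, where `M` bounds the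
modulus of the transform. -/
lemma IsDiscreteTransform.exists_pow_bound {h : ℝ → ℂ} {C M δ : ℝ}
    (hh : IsDiscreteTransform h C) (hM : ∀ t, ‖h t‖ ≤ M) (hδ : 0 < δ) :
    ∃ m : ℕ, ∀ k : ℕ, IsDiscreteTransform (fun t => h t ^ k) (((k : ℝ) + 1) ^ m * (M + δ) ^ k) := by
  classical
  have hM0 : 0 ≤ M := (norm_nonneg _).trans (hM 0)
  obtain ⟨ι, hι, a, x, ha, hC, hs⟩ := hh
  -- Split off a finite part; the remainder has total variation `ε`, and the supremum of the
  -- finite part exceeds `M` by at most `ε`.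
  obtain ⟨s, hs'⟩ : ∃ s : Finset ι, ∑' i : {i // i ∉ s}, |a i| < δ / 2 :=
    ((tendsto_order.1 (tendsto_tsum_compl_atTop_zero fun i => |a i|)).2 _ (half_pos hδ)).exists
  set P : ℝ → ℂ := fun t => ∑ i ∈ s, (a i : ℂ) * Complex.exp (Complex.I * (t : ℂ) * (x i : ℂ))
    with hP
  have hE : IsDiscreteTransform (fun t => h t - P t) (δ / 2) := by
    refine ⟨{i // i ∉ s}, inferInstance, fun i => a i, fun i => x i,
      ha.subtype _, hs'.le, fun t => ?_⟩
    have := (Finset.hasSum_compl_iff (f := fun i => (a i : ℂ) *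
      Complex.exp (Complex.I * (t : ℂ) * (x i : ℂ))) s (a := h t - P t)).2
    rw [hP, sub_add_cancel] at this
    exact this (hs t)
  have hPM : ∀ t, ‖P t‖ ≤ M + δ / 2 := fun t => by
    have h1 := hE.norm_le t
    have h2 := norm_sub_le (h t) (h t - P t)
    rw [sub_sub_cancel] at h2
    linarith [hM t]
  refine ⟨s.card, fun k => ?_⟩
  have hbin : ∀ t, h t ^ k = ∑ j ∈ Finset.range (k + 1),
      ((k.choose j : ℝ) : ℂ) * (P t ^ j * (h t - P t) ^ (k - j)) := by
    intro t
    conv_lhs => rw [show h t = P t + (h t - P t) by ring, add_pow]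
    refine Finset.sum_congr rfl fun j _ => ?_
    push_cast
    ring
  simp_rw [hbin]
  refine (IsDiscreteTransform.sum fun j => (((isDiscreteTransform_trigPoly_pow s hPM j).mul
    (hE.pow (k - j))).const_mul (k.choose j))).mono ?_
  have hkey : (M + δ) ^ k = ∑ j ∈ Finset.range (k + 1),
      (k.choose j : ℝ) * ((M + δ / 2) ^ j * (δ / 2) ^ (k - j)) := by
    rw [show M + δ = (M + δ / 2) + δ / 2 by ring, add_pow]
    exact Finset.sum_congr rfl fun j _ => by ring
  rw [hkey, Finset.mul_sum]
  refine Finset.sum_le_sum fun j hj => ?_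
  have hjk : (j : ℝ) ≤ k := by exact_mod_cast Nat.lt_succ_iff.1 (Finset.mem_range.1 hj)
  have h3 : ((j : ℝ) + 1) ^ s.card ≤ ((k : ℝ) + 1) ^ s.card := by gcongr
  rw [abs_of_nonneg (by positivity)]
  calc (k.choose j : ℝ) * (((j : ℝ) + 1) ^ s.card * (M + δ / 2) ^ j * (δ / 2) ^ (k - j))
      = ((j : ℝ) + 1) ^ s.card *
          ((k.choose j : ℝ) * ((M + δ / 2) ^ j * (δ / 2) ^ (k - j))) := by ring
    _ ≤ _ := mul_le_mul_of_nonneg_right h3 (by positivity)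

/-! ### The mass of the absolutely continuous part -/

/-- The mass of the absolutely continuous part of a measure on the line. -/
noncomputable def acMass (μ : Measure ℝ) : ℝ :=
  (volume.withDensity (μ.rnDeriv volume)).real univ

/-- A suitable Lebesgue null set carries the singular part of `μ`, and so does every larger null
set; the complement then has the mass of the absolutely continuous part. -/
lemma exists_null_forall_compl_eq_acMass (μ : Measure ℝ) [IsFiniteMeasure μ] :
    ∃ N : Set ℝ, volume N = 0 ∧
      ∀ N', N ⊆ N' → volume N' = 0 → μ.real N'ᶜ = acMass μ := by
  obtain ⟨s, -, hs0, hsc⟩ := Measure.mutuallySingular_singularPart μ volume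
  refine ⟨sᶜ, hsc, fun N' hN' h0 => ?_⟩
  have h1 : μ.singularPart volume N'ᶜ = 0 :=
    measure_mono_null (compl_subset_comm.1 hN') hs0
  have h2 : volume.withDensity (μ.rnDeriv volume) N' = 0 := withDensity_absolutelyContinuous _ _ h0
  have h3 : μ N'ᶜ = volume.withDensity (μ.rnDeriv volume) N'ᶜ := by
    conv_lhs => rw [Measure.haveLebesgueDecomposition_add μ volume]
    rw [Measure.add_apply, h1, zero_add]
  have h4 : volume.withDensity (μ.rnDeriv volume) N'ᶜ =
      volume.withDensity (μ.rnDeriv volume) univ :=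
    measure_congr (by simpa [Filter.eventuallyEq_univ, mem_ae_iff] using h2)
  rw [measureReal_def, h3, h4, acMass, measureReal_def]

lemma acMass_nonneg (μ : Measure ℝ) : 0 ≤ acMass μ := measureReal_nonneg

lemma exists_measurable_null_compl_eq_acMass (μ : Measure ℝ) [IsFiniteMeasure μ] :
    ∃ N : Set ℝ, MeasurableSet N ∧ volume N = 0 ∧ μ.real Nᶜ = acMass μ := by
  obtain ⟨N, hN, h⟩ := exists_null_forall_compl_eq_acMass μ
  refine ⟨toMeasurable volume N, measurableSet_toMeasurable _ _, ?_, ?_⟩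
  · rwa [measure_toMeasurable]
  · exact h _ (subset_toMeasurable _ _) (by rwa [measure_toMeasurable])

lemma acMass_le_one (μ : Measure ℝ) [IsProbabilityMeasure μ] : acMass μ ≤ 1 := by
  obtain ⟨N, -, -, h⟩ := exists_measurable_null_compl_eq_acMass μ
  rw [← h]
  exact measureReal_le_one

lemma real_univ_le_acMass {μ ν : Measure ℝ} [IsFiniteMeasure μ] (hν : ν ≪ volume) (hle : ν ≤ μ) :
    ν.real univ ≤ acMass μ := by
  obtain ⟨N, -, hN, h⟩ := exists_measurable_null_compl_eq_acMass μ
  have h1 : ν Nᶜ = ν univ := measure_congr (by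
    simpa [Filter.eventuallyEq_univ, mem_ae_iff] using hν hN)
  rw [← h, measureReal_def, measureReal_def, ← h1]
  exact ENNReal.toReal_mono (measure_ne_top _ _) (hle _)

lemma acMass_eq_zero {μ : Measure ℝ} [IsFiniteMeasure μ] (hμ : μ ⟂ₘ volume) : acMass μ = 0 := by
  rw [acMass, measureReal_def, withDensity_apply _ MeasurableSet.univ,
    lintegral_congr_ae (g := 0) (by simpa using hμ.rnDeriv_ae_eq_zero)]
  simp

/-- Convolution with a law preserves absolute continuity, so it cannot decrease the mass of the
absolutely continuous part. -/
lemma acMass_le_acMass_conv (μ ν : Measure ℝ) [IsFiniteMeasure μ] [IsProbabilityMeasure ν] :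
    acMass μ ≤ acMass (μ ∗ ν) := by
  set A := volume.withDensity (μ.rnDeriv volume) with hA
  have hfin : IsFiniteMeasure A := isFiniteMeasure_of_le μ (Measure.withDensity_rnDeriv_le μ volume)
  have h1 : A ∗ ν ≪ volume := by
    rw [Measure.conv_comm]
    exact Measure.conv_absolutelyContinuous (withDensity_absolutelyContinuous _ _)
  have h2 : A ∗ ν ≤ μ ∗ ν := by
    conv_rhs => rw [Measure.haveLebesgueDecomposition_add μ volume, Measure.add_conv]
    exact Measure.le_add_left le_rfl
  have h3 : (A ∗ ν).real univ = A.real univ := by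
    rw [Measure.conv, map_measureReal_apply (by fun_prop) MeasurableSet.univ, preimage_univ,
      ← univ_prod_univ, measureReal_prod_prod]
    simp
  have := real_univ_le_acMass h1 h2
  rwa [h3] at this

/-! ### Series of laws with real weights -/

section WeightedSeries

variable {J : Type} {ν : J → Measure ℝ} [∀ j, IsProbabilityMeasure (ν j)]

lemma isFiniteMeasure_sum {c : J → ℝ} (hc0 : ∀ j, 0 ≤ c j) (hc : Summable c) :
    IsFiniteMeasure (Measure.sum fun j => ENNReal.ofReal (c j) • ν j) := by
  refine ⟨?_⟩
  rw [Measure.sum_apply _ MeasurableSet.univ]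
  simp only [Measure.smul_apply, measure_univ, smul_eq_mul, mul_one]
  rw [← ENNReal.ofReal_tsum_of_nonneg hc0 hc]
  exact ENNReal.ofReal_lt_top

lemma hasSum_integral_sum {c : J → ℝ} (hc0 : ∀ j, 0 ≤ c j) (hc : Summable c)
    {E : Type} [NormedAddCommGroup E] [NormedSpace ℝ E] {f : ℝ → E}
    (hf : StronglyMeasurable f) (hf1 : ∀ x, ‖f x‖ ≤ 1) :
    HasSum (fun j => c j • ∫ x, f x ∂ν j)
      (∫ x, f x ∂Measure.sum fun j => ENNReal.ofReal (c j) • ν j) := by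
  have := isFiniteMeasure_sum (ν := ν) hc0 hc
  have h := hasSum_integral_measure (f := f)
    (μ := fun j => ENNReal.ofReal (c j) • ν j)
    (Integrable.of_bound hf.aestronglyMeasurable 1 (.of_forall hf1))
  simpa [integral_smul_measure, ENNReal.toReal_ofReal, hc0] using h

/-- If the transform of a signed measure `p - q` is an absolutely convergent series of
characteristic functions with real weights, then `p - q` is the corresponding series of laws. -/
lemma hasSum_real_of_hasSum_charFun {b : J → ℝ} (hb : Summable fun j => |b j|)
    {p q : Measure ℝ} [IsFiniteMeasure p] [IsFiniteMeasure q]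
    (h : ∀ t, HasSum (fun j => (b j : ℂ) * charFun (ν j) t) (charFun p t - charFun q t))
    {A : Set ℝ} (hA : MeasurableSet A) :
    HasSum (fun j => b j * (ν j).real A) (p.real A - q.real A) := by
  have hpos : Summable fun j => (b j)⁺ :=
    hb.of_nonneg_of_le (fun j => posPart_nonneg _) fun j =>
      sup_le (le_abs_self _) (abs_nonneg _)
  have hneg : Summable fun j => (b j)⁻ :=
    hb.of_nonneg_of_le (fun j => negPart_nonneg _) fun j =>
      sup_le (neg_le_abs _) (abs_nonneg _)
  have f1 := isFiniteMeasure_sum (ν := ν) (fun j => posPart_nonneg (b j)) hpos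
  have f2 := isFiniteMeasure_sum (ν := ν) (fun j => negPart_nonneg (b j)) hneg
  set P := Measure.sum fun j => ENNReal.ofReal ((b j)⁺) • ν j
  set Q := Measure.sum fun j => ENNReal.ofReal ((b j)⁻) • ν j
  have hsub : ∀ j, b j = (b j)⁺ - (b j)⁻ := fun j => (posPart_sub_negPart _).symm
  have hchar : ∀ {c : J → ℝ} (hc0 : ∀ j, 0 ≤ c j) (hc : Summable c) (t : ℝ),
      HasSum (fun j => (c j : ℂ) * charFun (ν j) t)
        (charFun (Measure.sum fun j => ENNReal.ofReal (c j) • ν j) t) := by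
    intro c hc0 hc t
    simp_rw [charFun_apply_real]
    have := hasSum_integral_sum (ν := ν) hc0 hc
      (f := fun x : ℝ => Complex.exp (t * x * Complex.I))
      (by apply Continuous.stronglyMeasurable; fun_prop) fun x => by
        rw [show (t : ℂ) * x * Complex.I = Complex.I * t * x by ring, norm_exp_I_mul_mul]
    simpa only [Complex.real_smul] using this
  have hmass : ∀ {c : J → ℝ} (hc0 : ∀ j, 0 ≤ c j) (hc : Summable c),
      HasSum (fun j => c j * (ν j).real A)
        ((Measure.sum fun j => ENNReal.ofReal (c j) • ν j).real A) := by
    intro c hc0 hc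
    have := hasSum_integral_sum (ν := ν) hc0 hc (f := A.indicator (1 : ℝ → ℝ))
      (stronglyMeasurable_one.indicator hA) fun x => by
        by_cases hx : x ∈ A <;> simp [hx]
    simpa only [integral_indicator_one hA, smul_eq_mul] using this
  have heq : p + Q = q + P := by
    refine Measure.ext_of_charFun (funext fun t => ?_)
    have e1 := (hchar (fun j => posPart_nonneg (b j)) hpos t).sub
      (hchar (fun j => negPart_nonneg (b j)) hneg t)
    have e2 : (fun j => (b j : ℂ) * charFun (ν j) t) = fun j =>
        (((b j)⁺ : ℝ) : ℂ) * charFun (ν j) t - (((b j)⁻ : ℝ) : ℂ) * charFun (ν j) t := by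
      ext j
      conv_lhs => rw [hsub j]
      push_cast
      ring
    have e3 := h t
    rw [e2] at e3
    have e4 := e3.unique e1
    rw [charFun_add_measure, charFun_add_measure]
    linear_combination e4
  have e1 := (hmass (fun j => posPart_nonneg (b j)) hpos).sub
    (hmass (fun j => negPart_nonneg (b j)) hneg)
  have e2 : (p + Q).real A = (q + P).real A := by rw [heq]
  rw [measureReal_add_apply, measureReal_add_apply] at e2
  have e3 : p.real A - q.real A = P.real A - Q.real A := by linarith
  rw [e3]
  refine e1.congr_fun fun j => ?_
  conv_lhs => rw [hsub j]
  ring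

end WeightedSeries

/-! ### Convolution powers -/

instance isProbabilityMeasure_convPow (μ : Measure ℝ) [IsProbabilityMeasure μ] (n : ℕ) :
    IsProbabilityMeasure (convPow μ n) := by
  induction n with
  | zero => exact inferInstanceAs (IsProbabilityMeasure (Measure.dirac 0))
  | succ n ih => exact inferInstanceAs (IsProbabilityMeasure (convPow μ n ∗ μ))

lemma charFun_convPow (μ : Measure ℝ) [IsProbabilityMeasure μ] (n : ℕ) (t : ℝ) :
    charFun (convPow μ n) t = charFun μ t ^ n := by
  induction n with
  | zero => simp [convPow]
  | succ n ih => rw [convPow, charFun_conv, ih, pow_succ]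

lemma acMass_convPow_mono (μ : Measure ℝ) [IsProbabilityMeasure μ] :
    Monotone fun n => acMass (convPow μ n) :=
  monotone_nat_of_le_succ fun _ => acMass_le_acMass_conv _ _

/-- Evaluate the identity `p - q = ∑ₖ sₖ μ^{*k} ∗ gₖ`, in which the `gₖ` are real discrete
measures of mass one, on the complement of a null set that carries all singular parts: what remains
is the mass of the absolutely continuous part, and convolution with `gₖ` does not change it. -/
lemma hasSum_acMass_convPow {μ p q : Measure ℝ} [IsProbabilityMeasure μ] [IsFiniteMeasure p]
    [IsFiniteMeasure q] (hp : p ⟂ₘ volume) (hq : q ⟂ₘ volume) {s B : ℕ → ℝ} {H : ℕ → ℝ → ℂ}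
    (hH : ∀ k, IsDiscreteTransform (H k) (B k)) (hH0 : ∀ k, H k 0 = 1)
    (hsB : Summable fun k => |s k| * B k)
    (h : ∀ t, HasSum (fun k => (s k : ℂ) * charFun μ t ^ k * H k t) (charFun p t - charFun q t)) :
    HasSum (fun k => s k * acMass (convPow μ k)) 0 := by
  choose ι hι a x ha hC hs using hH
  have hsum : Summable fun j : Σ k, ι k => |s j.1 * a j.1 j.2| := by
    refine (summable_sigma_of_nonneg fun _ => abs_nonneg _).2 ⟨fun k => ?_, ?_⟩
    · simpa only [abs_mul] using (ha k).mul_left _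
    · refine hsB.of_nonneg_of_le (fun k => tsum_nonneg fun i => abs_nonneg _) fun k => ?_
      simp only [abs_mul, tsum_mul_left]
      exact mul_le_mul_of_nonneg_left (hC k) (abs_nonneg _)
  let ν : (Σ k, ι k) → Measure ℝ := fun j => (convPow μ j.1).map (· + x j.1 j.2)
  have hν : ∀ j, IsProbabilityMeasure (ν j) := fun j =>
    Measure.isProbabilityMeasure_map (by fun_prop)
  have hchar : ∀ t, HasSum (fun j : Σ k, ι k => ((s j.1 * a j.1 j.2 : ℝ) : ℂ) * charFun (ν j) t)
      (charFun p t - charFun q t) := by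
    intro t
    have hsum' : Summable fun j : Σ k, ι k =>
        ((s j.1 * a j.1 j.2 : ℝ) : ℂ) * charFun (ν j) t := by
      refine Summable.of_norm_bounded hsum fun j => ?_
      rw [norm_mul, Complex.norm_real, Real.norm_eq_abs]
      exact mul_le_of_le_one_right (abs_nonneg _) (norm_charFun_le_one t)
    have h1 : HasSum (fun k => (s k : ℂ) * charFun μ t ^ k * H k t) _ :=
      hsum'.hasSum.sigma fun k => by
        refine ((hs k t).mul_left ((s k : ℂ) * charFun μ t ^ k)).congr_fun fun i => ?_
        simp only [ν]
        rw [charFun_map_add_const, charFun_convPow]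
        push_cast
        simp only [RCLike.inner_apply, conj_trivial]
        push_cast
        ring_nf
    rw [(h t).unique h1]
    exact hsum'.hasSum
  choose N hN0 hN using fun k => exists_null_forall_compl_eq_acMass (convPow μ k)
  obtain ⟨Sp, hSpm, hSp0, hSpv⟩ := hp
  obtain ⟨Sq, hSqm, hSq0, hSqv⟩ := hq
  set N' : Set ℝ := toMeasurable volume
    (Spᶜ ∪ Sqᶜ ∪ ⋃ j : Σ k, ι k, (· - x j.1 j.2) ⁻¹' N j.1) with hN'
  have hm : MeasurableSet N' := measurableSet_toMeasurable _ _
  have hsub := subset_toMeasurable volume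
    (Spᶜ ∪ Sqᶜ ∪ ⋃ j : Σ k, ι k, (· - x j.1 j.2) ⁻¹' N j.1)
  have h0 : volume N' = 0 := by
    rw [hN', measure_toMeasurable]
    refine measure_union_null (measure_union_null hSpv hSqv) (measure_iUnion_null fun j => ?_)
    simp_rw [sub_eq_add_neg]
    rw [measure_preimage_add_right, hN0]
  have hpN : p N'ᶜ = 0 := measure_mono_null
    (compl_subset_comm.1 ((subset_union_left.trans subset_union_left).trans hsub)) hSp0
  have hqN : q N'ᶜ = 0 := measure_mono_null
    (compl_subset_comm.1 ((subset_union_right.trans subset_union_left).trans hsub)) hSq0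
  have hνN : ∀ j, (ν j).real N'ᶜ = acMass (convPow μ j.1) := by
    intro j
    simp only [ν]
    rw [map_measureReal_apply (by fun_prop) hm.compl, preimage_compl]
    refine hN j.1 _ ?_ ?_
    · intro y hy
      refine hsub (Or.inr (mem_iUnion.2 ⟨j, ?_⟩))
      simpa using hy
    · rw [measure_preimage_add_right, h0]
  have key := hasSum_real_of_hasSum_charFun hsum hchar hm.compl
  simp only [hνN, measureReal_def, hpN, hqN, ENNReal.toReal_zero, sub_zero] at key
  refine key.sigma fun k => ?_
  have hone : HasSum (fun i => a k i) 1 := by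
    have := hs k 0
    rw [hH0] at this
    simp only [Complex.ofReal_zero, mul_zero, zero_mul, Complex.exp_zero, mul_one] at this
    rw [← Complex.ofReal_one] at this
    exact Complex.hasSum_ofReal.1 this
  have := (hone.mul_left (s k * acMass (convPow μ k)))
  rw [mul_one] at this
  exact this.congr_fun fun i => by ring

/-! ### The signed measure of a continuous singular function -/

/-- The Stieltjes exponent of a continuous singular function `W` is, up to its value at the origin,
the difference of the characteristic functions of the Jordan parts of `dW`, which are singular
measures without atoms. -/
lemma exists_jordan_stieltjesExponent {W : ℝ → ℝ} (hW : IsBV W) (hs : IsContSingularFun W) :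
    ∃ p q : Measure ℝ, IsFiniteMeasure p ∧ IsFiniteMeasure q ∧ IsContSingular p ∧
      IsContSingular q ∧ ∀ t, stieltjesExponent hW t =
        (charFun p t - charFun q t) - ((p.real univ - q.real univ : ℝ) : ℂ) := by
  obtain ⟨hc, hW', hsing⟩ := hs
  set w : SignedMeasure ℝ := hW.boundedVariation.vectorMeasure with hw
  set j := w.toJordanDecomposition with hj
  have hatom : ∀ x, w {x} = 0 := by
    intro x
    rw [hw, BoundedVariationOn.vectorMeasure_singleton, (hc.continuousWithinAt).rightLim_eq,
      (hc.continuousWithinAt).leftLim_eq, sub_self]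
  have hvar : w.variation = j.posPart + j.negPart := by
    rw [← SignedMeasure.totalVariation_eq_variation]
    rfl
  have hvar0 : ∀ x, w.variation {x} = 0 := by
    intro x
    rw [VectorMeasure.variation_apply_eq_zero (measurableSet_singleton x)]
    intro t ht _
    rcases subset_singleton_iff_eq.1 ht with rfl | rfl
    · simp
    · exact hatom x
  have hsing' : w.variation ⟂ₘ volume := hsing
  have hple : j.posPart ≤ w.variation := hvar ▸ Measure.le_add_right le_rfl
  have hqle : j.negPart ≤ w.variation := hvar ▸ Measure.le_add_left le_rfl
  refine ⟨j.posPart, j.negPart, inferInstance, inferInstance,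
    ⟨fun x => le_antisymm ((hple _).trans (hvar0 x).le) bot_le, ?_⟩,
    ⟨fun x => le_antisymm ((hqle _).trans (hvar0 x).le) bot_le, ?_⟩, fun t => ?_⟩
  · exact hsing'.mono_ac hple.absolutelyContinuous .rfl
  · exact hsing'.mono_ac hqle.absolutelyContinuous .rfl
  have hbound : ∀ x : ℝ, ‖Complex.exp (Complex.I * (t : ℂ) * (x : ℂ)) - 1‖ ≤ 2 := fun x => by
    refine (norm_sub_le _ _).trans ?_
    rw [norm_exp_I_mul_mul, norm_one]
    norm_num
  have hint : ∀ μ : Measure ℝ, IsFiniteMeasure μ →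
      Integrable (fun x : ℝ => Complex.exp (Complex.I * (t : ℂ) * (x : ℂ)) - 1) μ := fun μ _ =>
    Integrable.of_bound (by fun_prop) 2 (.of_forall hbound)
  have hexp : ∀ μ : Measure ℝ, IsFiniteMeasure μ →
      ∫ x, (Complex.exp (Complex.I * (t : ℂ) * (x : ℂ)) - 1) ∂μ =
        charFun μ t - (μ.real univ : ℂ) := by
    intro μ _
    rw [integral_sub, charFun_apply_real]
    · simp only [integral_const, Complex.real_smul, mul_one]
      congr 2 with x
      ring_nf
    · exact Integrable.of_bound (by fun_prop) 1 (.of_forall fun x => (norm_exp_I_mul_mul t x).le)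
    · exact integrable_const _
  have hfin : IsFiniteMeasure w.variation := by rw [hvar]; infer_instance
  rw [stieltjesExponent, VectorMeasure.setIntegral_compl (measurableSet_singleton _)
    (hint _ hfin), VectorMeasure.setIntegral_eq_zero_of_forall_eq_zero (t := {(0 : ℝ)}) (by simp),
    sub_zero]
  change VectorMeasure.integral w _ _ = _
  rw [← w.toSignedMeasure_toJordanDecomposition, JordanDecomposition.toSignedMeasure,
    VectorMeasure.integral_sub_vectorMeasure, VectorMeasure.integral_toSignedMeasure,
    VectorMeasure.integral_toSignedMeasure, hexp _ inferInstance, hexp _ inferInstance]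
  · push_cast
    ring
  · rw [VectorMeasure.Integrable, Measure.variation_toSignedMeasure]
    exact hint _ inferInstance
  · rw [VectorMeasure.Integrable, Measure.variation_toSignedMeasure]
    exact hint _ inferInstance

/-! ### An alternating series -/

/-- The weights `βₖ` vanish for `k < n`, increase in `[0, 1]` and jump to at least `α` at `n`. Write
`βₖ = 1 - γₖ` for `k ≥ n`: the series with `1` exceeds its first two terms, and the series with
the decreasing `γₖ` is at most its first term. -/
lemma not_hasSum_alternating {β : ℕ → ℝ} {r α : ℝ} {n : ℕ} (hn : 1 ≤ n) (hr0 : 0 < r) (hr1 : r < 1)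
    (hmono : Monotone β) (h1 : ∀ k, β k ≤ 1) (hlt : ∀ k < n, β k = 0) (hα : α ≤ β n)
    (hαr : (n : ℝ) / ((n : ℝ) + 1) * r ≤ α) :
    ¬ HasSum (fun k : ℕ => ((-1) ^ (k + 1) * r ^ k / k) * β k) 0 := by
  intro hsum
  have hn0 : (0 : ℝ) < n := by exact_mod_cast hn
  set x : ℕ → ℝ := fun j => r ^ (n + j) / ((n : ℝ) + j) with hx
  have hx0 : ∀ j, 0 < x j := fun j => by positivity
  have hxanti : StrictAnti x := strictAnti_nat_of_succ_lt fun j => by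
    simp only [hx]
    have h2 : r ^ (n + (j + 1)) < r ^ (n + j) := pow_lt_pow_right_of_lt_one₀ hr0 hr1 (by omega)
    have h3 : (n : ℝ) + j ≤ n + ((j + 1 : ℕ) : ℝ) := by push_cast; linarith
    exact div_lt_div₀ h2 h3 (by positivity) (by positivity)
  have hxle : ∀ j, x j ≤ r ^ j := fun j => by
    have hn1 : (1 : ℝ) ≤ n := by exact_mod_cast hn
    have h2 : (1 : ℝ) ≤ (n : ℝ) + j := by
      have : (0 : ℝ) ≤ j := by positivity
      linarith
    calc x j ≤ r ^ (n + j) := div_le_self (by positivity) h2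
      _ ≤ r ^ j := pow_le_pow_of_le_one hr0.le hr1.le (by omega)
  have hβ0 : ∀ j, 0 ≤ β j := fun j =>
    (hlt 0 (by omega)).symm.le.trans (hmono (Nat.zero_le j))
  have hgeo : Summable fun j : ℕ => r ^ j := summable_geometric_of_lt_one hr0.le hr1
  have hsx : Summable fun j : ℕ => (-1) ^ j * x j := by
    refine Summable.of_norm_bounded hgeo fun j => ?_
    rw [norm_mul, norm_pow, norm_neg, norm_one, one_pow, one_mul, Real.norm_of_nonneg (hx0 j).le]
    exact hxle j
  have hsy : Summable fun j : ℕ => (-1) ^ j * (x j * (1 - β (n + j))) := by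
    refine Summable.of_norm_bounded hgeo fun j => ?_
    have h2 : 0 ≤ 1 - β (n + j) := sub_nonneg.2 (h1 _)
    rw [norm_mul, norm_pow, norm_neg, norm_one, one_pow, one_mul,
      Real.norm_of_nonneg (mul_nonneg (hx0 j).le h2)]
    exact (mul_le_of_le_one_right (hx0 j).le (by linarith [hβ0 (n + j)])).trans (hxle j)
  have hyanti : Antitone fun j => x j * (1 - β (n + j)) := fun i j hij =>
    mul_le_mul (hxanti.antitone hij) (sub_le_sub_left (hmono (by omega)) _)
      (sub_nonneg.2 (h1 _)) (hx0 i).le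
  have hlow := hxanti.antitone.alternating_series_le_tendsto hsx.hasSum.tendsto_sum_nat 2
  have hup := hyanti.tendsto_le_alternating_series hsy.hasSum.tendsto_sum_nat 0
  simp only [Finset.sum_range_succ, Finset.sum_range_zero] at hlow hup
  norm_num at hlow hup
  have htail : HasSum (fun j : ℕ => ((-1) ^ (n + j + 1) * r ^ (n + j) / ((n + j : ℕ) : ℝ)) *
      β (n + j)) 0 := by
    have h2 := (hasSum_nat_add_iff' n).2 hsum
    rw [Finset.sum_eq_zero fun k hk => by rw [hlt k (Finset.mem_range.1 hk), mul_zero],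
      sub_zero] at h2
    simpa only [add_comm _ n] using h2
  have hzero : ∑' j : ℕ, (-1) ^ j * x j - ∑' j : ℕ, (-1) ^ j * (x j * (1 - β (n + j))) = 0 := by
    rw [← hsx.tsum_sub hsy]
    have h2 := htail.mul_left ((-1 : ℝ) ^ (n + 1))
    rw [mul_zero] at h2
    rw [← h2.tsum_eq]
    refine tsum_congr fun j => ?_
    simp only [hx]
    have h3 : ((-1 : ℝ) ^ (n + 1)) * (-1) ^ (n + j + 1) = (-1) ^ j := by
      rw [← pow_add, show n + 1 + (n + j + 1) = 2 * (n + 1) + j by ring, pow_add, pow_mul]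
      simp
    rw [← h3]
    push_cast
    ring
  have h5 : x 1 ≤ α * x 0 := by
    have : x 1 = (n : ℝ) / ((n : ℝ) + 1) * r * x 0 := by
      simp only [hx, Nat.cast_zero, Nat.cast_one, add_zero]
      field_simp
      ring
    rw [this]
    exact mul_le_mul_of_nonneg_right hαr (hx0 0).le
  have h6 : α * x 0 ≤ β n * x 0 := mul_le_mul_of_nonneg_right hα (hx0 0).le
  have h7 := hxanti (show 2 < 3 by norm_num)
  linarith

/-! ### Uniqueness of the discrete factor and the logarithmic series -/

/-- If `e^{p̂ - q̂}` with measures `p` and `q` without atoms, multiplied by the transform `E` of a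
discrete measure, is the transform of a measure with discrete part `cd • Fd`, then this discrete
part has the transform `E`: since `e^{p̂ - q̂} - 1` has quadratic mean zero, so has
`cd f_d - E`. -/
lemma discreteFactor_unique {p q Fd Fs : Measure ℝ} [IsFiniteMeasure p] [IsFiniteMeasure q]
    [IsProbabilityMeasure Fd] [IsProbabilityMeasure Fs] {cd cs C : ℝ} {E : ℝ → ℂ}
    (hp : ∀ x, p {x} = 0) (hq : ∀ x, q {x} = 0) (hFs : ∀ x, Fs {x} = 0) (hFd : IsDiscrete Fd)
    (hE : IsDiscreteTransform E C)
    (h : ∀ t, (cd : ℂ) * charFun Fd t + (cs : ℂ) * charFun Fs t =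
      E t * Complex.exp (charFun p t - charFun q t)) (t : ℝ) :
    (cd : ℂ) * charFun Fd t = E t := by
  have hw : IsMeanNull fun t => charFun p t - charFun q t :=
    (isMeanNull_charFun hp).sub (isMeanNull_charFun hq)
  obtain ⟨B, hB⟩ := hw.bounded
  have hexp : IsMeanNull fun t => E t * (Complex.exp (charFun p t - charFun q t) - 1) := by
    refine hw.of_norm_le ?_ (C * Real.exp B) fun t => ?_
    · exact hE.continuous.mul ((Complex.continuous_exp.comp hw.continuous).sub continuous_const)
    · have h1 := Complex.norm_exp_sub_sum_le_norm_mul_exp (charFun p t - charFun q t) 1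
      simp only [Finset.range_one, Finset.sum_singleton, pow_zero, Nat.factorial_zero,
        Nat.cast_one, div_one, pow_one] at h1
      rw [norm_mul]
      calc ‖E t‖ * ‖Complex.exp (charFun p t - charFun q t) - 1‖
          ≤ C * (‖charFun p t - charFun q t‖ * Real.exp B) := by
            refine mul_le_mul (hE.norm_le t) (h1.trans ?_) (norm_nonneg _) hE.nonneg
            exact mul_le_mul_of_nonneg_left (Real.exp_le_exp.2 (hB t)) (norm_nonneg _)
        _ = _ := by ring
  have hdisc := ((isDiscreteTransform_charFun hFd).const_mul cd).add (hE.const_mul (-1))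
  have hnull : IsMeanNull fun t => (cd : ℂ) * charFun Fd t + ((-1 : ℝ) : ℂ) * E t := by
    have h2 := hexp.sub ((isMeanNull_charFun hFs).const_mul cs)
    convert h2 using 2 with t
    push_cast
    linear_combination h t
  have h3 := hdisc.eq_zero_of_isMeanNull hnull t
  push_cast at h3
  linear_combination h3

/-- A continuous logarithm of `1 + z`, where `‖z‖ ≤ ρ < 1`, is the principal one as soon as both
the logarithm and `z` have quadratic mean zero: the difference is a constant in `2πiℤ`. -/
lemma eq_log_of_isMeanNull {w z : ℝ → ℂ} {ρ : ℝ} (hρ : ρ < 1) (hz : ∀ t, ‖z t‖ ≤ ρ)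
    (hw : IsMeanNull w) (hzn : IsMeanNull z) (h : ∀ t, Complex.exp (w t) = 1 + z t) (t : ℝ) :
    w t = Complex.log (1 + z t) := by
  have hz1 : ∀ t, ‖z t‖ < 1 := fun t => (hz t).trans_lt hρ
  have hslit : ∀ t, 1 + z t ∈ Complex.slitPlane := fun t =>
    Complex.mem_slitPlane_of_norm_lt_one (hz1 t)
  have hlogc : Continuous fun t => Complex.log (1 + z t) :=
    (continuous_const.add hzn.continuous).clog hslit
  have hlog : IsMeanNull fun t => Complex.log (1 + z t) := by
    refine hzn.of_norm_le hlogc ((1 - ρ)⁻¹ + 1) fun t => ?_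
    have h1 := Complex.norm_log_one_add_le (hz1 t)
    have h2 : (1 - ‖z t‖)⁻¹ ≤ (1 - ρ)⁻¹ :=
      inv_anti₀ (by linarith) (by linarith [hz t])
    have h3 : 0 ≤ (1 - ‖z t‖)⁻¹ := inv_nonneg.2 (by linarith [hz1 t])
    have h4 : ‖z t‖ ^ 2 ≤ ‖z t‖ := by nlinarith [norm_nonneg (z t), hz1 t]
    have h5 : ‖z t‖ ^ 2 * (1 - ‖z t‖)⁻¹ ≤ ‖z t‖ * (1 - ρ)⁻¹ :=
      mul_le_mul h4 h2 h3 (norm_nonneg _)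
    have h6 : 0 ≤ ‖z t‖ * (1 - ρ)⁻¹ :=
      mul_nonneg (norm_nonneg _) (inv_nonneg.2 (by linarith))
    nlinarith
  have hD : IsMeanNull fun t => w t - Complex.log (1 + z t) := hw.sub hlog
  have hint : ∀ t, ∃ n : ℤ, w t - Complex.log (1 + z t) = n * (2 * Real.pi * Complex.I) := by
    intro t
    rw [← Complex.exp_eq_one_iff, Complex.exp_sub, h,
      Complex.exp_log (Complex.slitPlane_ne_zero (hslit t)),
      div_self (Complex.slitPlane_ne_zero (hslit t))]
  have hval : ∀ (t : ℝ) (n : ℤ), w t - Complex.log (1 + z t) = n * (2 * Real.pi * Complex.I) →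
      (w t - Complex.log (1 + z t)).im / (2 * Real.pi) = n := by
    intro t n hn
    rw [hn]
    have : ((n : ℂ) * (2 * Real.pi * Complex.I)).im = n * (2 * Real.pi) := by simp
    rw [this]
    field_simp
  have hconst : ∀ t, w t - Complex.log (1 + z t) = w 0 - Complex.log (1 + z 0) := by
    intro t
    have hdisc : DiscreteTopology (range ((↑) : ℤ → ℝ)) :=
      Int.isClosedEmbedding_coe_real.isEmbedding.toHomeomorph.symm.isEmbedding.discreteTopology
    have heq := isPreconnected_univ.constant_of_mapsTo (T := range ((↑) : ℤ → ℝ)) ⟨hdisc⟩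
      (f := fun t => (w t - Complex.log (1 + z t)).im / (2 * Real.pi))
      ((Complex.continuous_im.comp hD.continuous).div_const _).continuousOn
      (fun t _ => by
        obtain ⟨n, hn⟩ := hint t
        exact ⟨n, (hval t n hn).symm⟩) (mem_univ t) (mem_univ 0)
    obtain ⟨n, hn⟩ := hint t
    obtain ⟨n', hn'⟩ := hint 0
    simp only [hval t n hn, hval 0 n' hn', Int.cast_inj] at heq
    rw [hn, hn', heq]
  have h0 : w 0 - Complex.log (1 + z 0) = 0 := by
    refine IsMeanNull.eq_zero_of_const ?_
    simpa only [hconst] using hD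
  exact sub_eq_zero.1 ((hconst t).trans h0)

lemma summable_succ_pow_mul_geometric (m : ℕ) {ρ : ℝ} (h0 : 0 < ρ) (h1 : ρ < 1) :
    Summable fun k : ℕ => ((k : ℝ) + 1) ^ m * ρ ^ k := by
  have h := summable_pow_mul_geometric_of_norm_lt_one m (r := ρ)
    (by rwa [Real.norm_of_nonneg h0.le])
  refine (((summable_nat_add_iff 1).2 h).mul_right ρ⁻¹).congr fun k => ?_
  push_cast
  rw [pow_succ]
  field_simp

/-- Expand the logarithm of `1 + r f_s / f_d`. Here `h = 1 / f_d` is the transform of a discrete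
measure and bounded by `M` with `r M < 1`, so that the series converges in total variation. -/
lemma hasSum_acMass_of_exp_eq {p q Fs : Measure ℝ} [IsFiniteMeasure p] [IsFiniteMeasure q]
    [IsProbabilityMeasure Fs] {r C M : ℝ} {h : ℝ → ℂ} (hp : IsContSingular p)
    (hq : IsContSingular q) (hFs : ∀ x, Fs {x} = 0) (hr : 0 < r) (hh : IsDiscreteTransform h C)
    (hM : ∀ t, ‖h t‖ ≤ M) (hrM : r * M < 1) (h0 : h 0 = 1)
    (hexp : ∀ t, Complex.exp (charFun p t - charFun q t) = 1 + r * charFun Fs t * h t) :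
    HasSum (fun k : ℕ => ((-1) ^ (k + 1) * r ^ k / k) * acMass (convPow Fs k)) 0 := by
  have hM1 : 1 ≤ M := by simpa [h0] using hM 0
  have hM0 : 0 < M := by linarith
  have hznorm : ∀ t, ‖(r : ℂ) * charFun Fs t * h t‖ ≤ r * M := fun t => by
    rw [norm_mul, norm_mul, Complex.norm_real, Real.norm_of_nonneg hr.le]
    exact mul_le_mul (mul_le_of_le_one_right hr.le (norm_charFun_le_one t)) (hM t)
      (norm_nonneg _) hr.le
  have hzn : IsMeanNull fun t => (r : ℂ) * charFun Fs t * h t := by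
    refine (isMeanNull_charFun hFs).of_norm_le ?_ (r * M) fun t => ?_
    · exact (continuous_const.mul continuous_charFun).mul hh.continuous
    · rw [norm_mul, norm_mul, Complex.norm_real, Real.norm_of_nonneg hr.le]
      have := mul_le_mul_of_nonneg_left (hM t) (mul_nonneg hr.le (norm_nonneg (charFun Fs t)))
      linarith
  have hlog := eq_log_of_isMeanNull hrM hznorm
    ((isMeanNull_charFun hp.1).sub (isMeanNull_charFun hq.1)) hzn hexp
  set δ := (1 - r * M) / (2 * r) with hδ
  have hδ0 : 0 < δ := div_pos (by linarith) (by positivity)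
  have hρ1 : r * (M + δ) < 1 := by
    have : r * δ = (1 - r * M) / 2 := by rw [hδ]; field_simp
    rw [mul_add, this]
    linarith
  obtain ⟨m, hm⟩ := hh.exists_pow_bound hM hδ0
  refine hasSum_acMass_convPow hp.2 hq.2 hm (fun k => by rw [h0, one_pow]) ?_ fun t => ?_
  · refine (summable_succ_pow_mul_geometric m (by positivity) hρ1).of_nonneg_of_le
      (fun k => by positivity) fun k => ?_
    have h1 : |(-1) ^ (k + 1) * r ^ k / (k : ℝ)| ≤ r ^ k := by
      rw [abs_div, abs_mul, abs_pow, abs_neg, abs_one, one_pow, one_mul,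
        abs_of_nonneg (by positivity), Nat.abs_cast]
      rcases k.eq_zero_or_pos with rfl | hk
      · simp
      · exact div_le_self (by positivity) (by exact_mod_cast hk)
    calc |(-1) ^ (k + 1) * r ^ k / (k : ℝ)| * (((k : ℝ) + 1) ^ m * (M + δ) ^ k)
        ≤ r ^ k * (((k : ℝ) + 1) ^ m * (M + δ) ^ k) :=
          mul_le_mul_of_nonneg_right h1 (by positivity)
      _ = ((k : ℝ) + 1) ^ m * (r * (M + δ)) ^ k := by rw [mul_pow]; ring
  · rw [hlog t]
    refine (Complex.hasSum_taylorSeries_log ((hznorm t).trans_lt hrM)).congr_fun fun k => ?_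
    push_cast
    ring

/-! ### The two factors of the characteristic function -/

lemma isDiscreteTransform_tsum_exp_sub_one {P : ℝ → Prop} {lam : {u : ℝ // P u} → ℝ}
    (hlam : Summable fun u => |lam u|) :
    ∃ C, IsDiscreteTransform (fun t => ∑' u : {u : ℝ // P u},
      (lam u : ℂ) * (Complex.exp (Complex.I * (t : ℂ) * ((u : ℝ) : ℂ)) - 1)) C := by
  have hcount : (Function.support lam).Countable := by
    refine hlam.countable_support.mono fun u hu => ?_
    simpa using hu
  have := hcount.to_subtype
  have hs1 : ∀ t : ℝ, Summable fun u : {u : ℝ // P u} =>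
      (lam u : ℂ) * Complex.exp (Complex.I * (t : ℂ) * ((u : ℝ) : ℂ)) := fun t =>
    Summable.of_norm (by simpa only [norm_ofReal_mul_exp_I] using hlam)
  have h1 : IsDiscreteTransform (fun t => ∑' u : {u : ℝ // P u},
      (lam u : ℂ) * Complex.exp (Complex.I * (t : ℂ) * ((u : ℝ) : ℂ)))
      (∑' u : Function.support lam, |lam u|) := by
    refine ⟨Function.support lam, inferInstance, fun u => lam u, fun u => (u : {u : ℝ // P u}),
      hlam.subtype _, le_rfl, fun t => ?_⟩
    refine (hasSum_subtype_iff_of_support_subset (f := fun u : {u : ℝ // P u} =>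
      (lam u : ℂ) * Complex.exp (Complex.I * (t : ℂ) * ((u : ℝ) : ℂ))) ?_).2 (hs1 t).hasSum
    intro u hu
    simp only [Function.mem_support] at hu ⊢
    exact fun h => hu (by simp [h])
  have h2 := h1.add (IsDiscreteTransform.const (-∑' u, lam u))
  refine ⟨(∑' u : Function.support lam, |lam u|) + |-∑' u, lam u|, ?_⟩
  convert h2 using 2 with t
  have h3 : Summable fun u => ((lam u : ℝ) : ℂ) := Summable.of_norm (by simpa using hlam)
  simp only [mul_sub, mul_one]
  rw [(hs1 t).tsum_sub h3]
  push_cast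
  ring

/-- Cancelling `R_a` in the Lévy representation leaves a representation of the discrete and the
continuous singular part of `F` alone. -/
lemma IsLevyRepresentation.discrete_add_singular {F Fd Fa Fs : Measure ℝ} {cd ca cs γ₀ : ℝ}
    {lam : {u : ℝ // u ∈ atomGroup Fd ∧ u ≠ 0} → ℝ} {v : ℝ → ℝ} {m : ℤ} {W : ℝ → ℝ}
    (hdec : IsLebesgueDecomposition F cd ca cs Fd Fa Fs)
    (hrep : IsLevyRepresentation F cd ca cs Fd Fa Fs γ₀ lam v m W) {t : ℝ}
    (hne : (cd : ℂ) * charFun Fd t + (cs : ℂ) * charFun Fs t ≠ 0) :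
    (cd : ℂ) * charFun Fd t + (cs : ℂ) * charFun Fs t = ((cd + cs : ℝ) : ℂ) *
      Complex.exp (discreteExponent Fd γ₀ lam t + stieltjesExponent hrep.isBV t) := by
  have := hdec.prob_d
  have := hdec.prob_a
  have := hdec.prob_s
  have fin : ∀ (c : ℝ) (μ : Measure ℝ) [IsProbabilityMeasure μ],
      IsFiniteMeasure (ENNReal.ofReal c • μ) := fun c μ _ => μ.smul_finite ENNReal.ofReal_ne_top
  have := fin cd Fd
  have := fin ca Fa
  have := fin cs Fs
  have hF : charFun F t =
      (cd : ℂ) * charFun Fd t + (ca : ℂ) * charFun Fa t + (cs : ℂ) * charFun Fs t := by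
    rw [hdec.eq, charFun_add_measure, charFun_add_measure, charFun_ofReal_smul _ hdec.cd_nonneg,
      charFun_ofReal_smul _ hdec.ca_nonneg, charFun_ofReal_smul _ hdec.cs_nonneg]
  have hRa : ((cd : ℂ) * charFun Fd t + (cs : ℂ) * charFun Fs t) * Ra cd ca cs Fd Fa Fs t =
      charFun F t := by
    rw [hF, Ra]
    field_simp
    ring
  have hE := hrep.factor_a t
  have hexp := hrep.repr t
  rw [show discreteExponent Fd γ₀ lam t + absContExponent v m t + stieltjesExponent hrep.isBV t =
    discreteExponent Fd γ₀ lam t + stieltjesExponent hrep.isBV t + absContExponent v m t by ring,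
    Complex.exp_add, ← hE, ← hRa] at hexp
  have hRa0 : Ra cd ca cs Fd Fa Fs t ≠ 0 := by
    intro h0
    rw [h0, mul_zero] at hE
    exact Complex.exp_ne_zero _ hE.symm
  refine mul_right_cancel₀ hRa0 (hexp.trans ?_)
  ring

/-- If `W` is purely continuous singular, then expanding `log (1 + (c_s / c_d) f_s / f_d)`
and taking masses of absolutely continuous parts gives a vanishing alternating series. -/
lemma IsLevyRepresentation.hasSum_acMass {F Fd Fa Fs : Measure ℝ} {cd ca cs γ₀ : ℝ}
    {lam : {u : ℝ // u ∈ atomGroup Fd ∧ u ≠ 0} → ℝ} {v : ℝ → ℝ} {m : ℤ} {W : ℝ → ℝ}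
    (hdec : IsLebesgueDecomposition F cd ca cs Fd Fa Fs) (hcd : 0 < cd) (hcs : 0 < cs)
    (hμ0 : 0 < infNormCharFun Fd) (hμ : cs < cd * infNormCharFun Fd)
    (hrep : IsLevyRepresentation F cd ca cs Fd Fa Fs γ₀ lam v m W) (hW : IsContSingularFun W) :
    HasSum (fun k : ℕ => ((-1) ^ (k + 1) * (cs / cd) ^ k / k) * acMass (convPow Fs k)) 0 := by
  have := hdec.prob_d
  have := hdec.prob_s
  have hinf : ∀ t, infNormCharFun Fd ≤ ‖charFun Fd t‖ := fun t =>
    ciInf_le ⟨0, by rintro _ ⟨t, rfl⟩; exact norm_nonneg _⟩ t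
  have hfd : ∀ t, charFun Fd t ≠ 0 := fun t => norm_pos_iff.1 (hμ0.trans_le (hinf t))
  have hcd' : (cd : ℂ) ≠ 0 := by exact_mod_cast hcd.ne'
  have hne : ∀ t, (cd : ℂ) * charFun Fd t + (cs : ℂ) * charFun Fs t ≠ 0 := by
    intro t h0
    have h1 : ‖(cd : ℂ) * charFun Fd t‖ = ‖(cs : ℂ) * charFun Fs t‖ := by
      rw [eq_neg_of_add_eq_zero_left h0, norm_neg]
    rw [norm_mul, norm_mul, Complex.norm_real, Complex.norm_real, Real.norm_of_nonneg hcd.le,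
      Real.norm_of_nonneg hcs.le] at h1
    have h2 := mul_le_mul_of_nonneg_left (hinf t) hcd.le
    have h3 := mul_le_mul_of_nonneg_left (norm_charFun_le_one (μ := Fs) t) hcs.le
    linarith
  obtain ⟨p, q, hpf, hqf, hp, hq, hst⟩ := exists_jordan_stieltjesExponent hrep.isBV hW
  obtain ⟨CL, hL⟩ := isDiscreteTransform_tsum_exp_sub_one hrep.summable_lam
  set L : ℝ → ℂ := fun t => ∑' u : {u : ℝ // u ∈ atomGroup Fd ∧ u ≠ 0},
    (lam u : ℂ) * (Complex.exp (Complex.I * (t : ℂ) * ((u : ℝ) : ℂ)) - 1) with hLdef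
  set c : ℝ := (cd + cs) * Real.exp (-(p.real univ - q.real univ)) with hc
  have hc0 : 0 < c := by positivity
  have hc0' : (c : ℂ) ≠ 0 := by exact_mod_cast hc0.ne'
  have hE := (IsDiscreteTransform.monomial c γ₀).mul hL.exp
  have hfac : ∀ t : ℝ, (cd : ℂ) * charFun Fd t + (cs : ℂ) * charFun Fs t =
      (c : ℂ) * Complex.exp (Complex.I * (t : ℂ) * (γ₀ : ℂ)) * Complex.exp (L t) *
        Complex.exp (charFun p t - charFun q t) := by
    intro t
    rw [hrep.discrete_add_singular hdec (hne t), discreteExponent, hst t, hc]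
    push_cast
    rw [show Complex.I * (t : ℂ) * (γ₀ : ℂ) + (∑' u : {u : ℝ // u ∈ atomGroup Fd ∧ u ≠ 0},
        (lam u : ℂ) * (Complex.exp (Complex.I * (t : ℂ) * ((u : ℝ) : ℂ)) - 1)) +
        (charFun p t - charFun q t - ((p.real univ : ℂ) - (q.real univ : ℂ))) =
      -((p.real univ : ℂ) - (q.real univ : ℂ)) + Complex.I * (t : ℂ) * (γ₀ : ℂ) + L t +
        (charFun p t - charFun q t) by rw [hLdef]; ring, Complex.exp_add, Complex.exp_add,
      Complex.exp_add]
    ring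
  have huniq := discreteFactor_unique hp.1 hq.1 hdec.contSingular.1 hdec.discrete hE hfac
  -- The inverse of the discrete factor, read off from its exponential form.
  set h : ℝ → ℂ := fun t =>
    ((cd / c : ℝ) : ℂ) * Complex.exp (Complex.I * (t : ℂ) * ((-γ₀ : ℝ) : ℂ)) *
      Complex.exp (((-1 : ℝ) : ℂ) * L t) with hh
  have hhdisc := (IsDiscreteTransform.monomial (cd / c) (-γ₀)).mul (hL.const_mul (-1)).exp
  have hinv : ∀ t, h t * charFun Fd t = 1 := by
    intro t
    refine mul_left_cancel₀ hcd' ?_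
    rw [show (cd : ℂ) * (h t * charFun Fd t) = h t * ((cd : ℂ) * charFun Fd t) by ring, huniq t]
    have h1 : Complex.exp (Complex.I * (t : ℂ) * ((-γ₀ : ℝ) : ℂ)) *
        Complex.exp (Complex.I * (t : ℂ) * (γ₀ : ℂ)) = 1 := by
      rw [← Complex.exp_add, Complex.exp_eq_one_iff]
      exact ⟨0, by push_cast; ring⟩
    have h2 : Complex.exp (((-1 : ℝ) : ℂ) * L t) * Complex.exp (L t) = 1 := by
      rw [← Complex.exp_add, Complex.exp_eq_one_iff]
      exact ⟨0, by push_cast; ring⟩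
    have h3 : ((cd / c : ℝ) : ℂ) * (c : ℂ) = cd := by
      push_cast
      field_simp
    calc _ = ((cd / c : ℝ) : ℂ) * (c : ℂ) *
          (Complex.exp (Complex.I * (t : ℂ) * ((-γ₀ : ℝ) : ℂ)) *
            Complex.exp (Complex.I * (t : ℂ) * (γ₀ : ℂ))) *
          (Complex.exp (((-1 : ℝ) : ℂ) * L t) * Complex.exp (L t)) := by rw [hh]; ring
      _ = _ := by rw [h1, h2, h3]; ring
  refine hasSum_acMass_of_exp_eq (h := h) (M := (infNormCharFun Fd)⁻¹) hp hq
    hdec.contSingular.1 (div_pos hcs hcd) hhdisc (fun t => ?_) ?_ ?_ fun t => ?_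
  · rw [eq_inv_of_mul_eq_one_left (hinv t), norm_inv]
    exact inv_anti₀ hμ0 (hinf t)
  · rw [← div_eq_mul_inv, div_div, div_lt_one (by positivity)]
    exact hμ
  · have := hinv 0
    rwa [charFun_zero, probReal_univ, Complex.ofReal_one, mul_one] at this
  · have h1 := hfac t
    rw [← huniq t] at h1
    refine mul_left_cancel₀ (mul_ne_zero hcd' (hfd t)) (h1.symm.trans ?_)
    have h2 := hinv t
    push_cast
    field_simp
    linear_combination (-(cs : ℂ) * charFun Fs t) * h2

end RationalInfDiv

theorem proposition1
    (F Fd Fa Fs : MeasureTheory.Measure ℝ) (cd ca cs : ℝ)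
    (hdec : RationalInfDiv.IsLebesgueDecomposition F cd ca cs Fd Fa Fs)
    (hcd : 0 < cd) (hcs : 0 < cs)
    (hdom : RationalInfDiv.HasDominatedSingularPart cd cs Fd)
    (hF : RationalInfDiv.IsRationalInfinitelyDivisible F)
    (γ₀ : ℝ) (lam : {u : ℝ // u ∈ RationalInfDiv.atomGroup Fd ∧ u ≠ 0} → ℝ)
    (v : ℝ → ℝ) (m : ℤ) (W : ℝ → ℝ)
    (hrep : RationalInfDiv.IsLevyRepresentation F cd ca cs Fd Fa Fs γ₀ lam v m W)
    (n : ℕ) (hn : 2 ≤ n)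
    (hsing : RationalInfDiv.IsContSingular (RationalInfDiv.convPow Fs (n - 1)))
    (α : ℝ) (hα0 : 0 < α) (hα1 : α ≤ 1)
    (Ha Hs : MeasureTheory.Measure ℝ)
    (hHa : MeasureTheory.IsProbabilityMeasure Ha) (hHs : MeasureTheory.IsProbabilityMeasure Hs)
    (hHa_ac : MeasureTheory.Measure.AbsolutelyContinuous Ha MeasureTheory.volume)
    (hHs_sing : RationalInfDiv.IsContSingular Hs)
    (hmix : RationalInfDiv.convPow Fs n =
      ENNReal.ofReal α • Ha + ENNReal.ofReal (1 - α) • Hs) :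
    ((n : ℝ) / ((n : ℝ) + 1) * (cs / cd) ≤ α → ¬ RationalInfDiv.IsContSingularFun W) ∧
      (α = 1 → ¬ RationalInfDiv.IsContSingularFun W) := by
  have hprob_s := hdec.prob_s
  have hprob_d := hdec.prob_d
  -- As `cs > 0`, the domination hypothesis forces `μ_d > 0` and reads `cs < cd * μ_d ≤ cd`.
  have hμ0 : 0 < RationalInfDiv.infNormCharFun Fd := by
    refine lt_of_le_of_ne (Real.iInf_nonneg fun t => norm_nonneg _) fun h0 => ?_
    exact hcs.ne' (hdom.2 h0.symm)
  have hμ := hdom.1 hμ0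
  have hμ1 : RationalInfDiv.infNormCharFun Fd ≤ 1 :=
    (ciInf_le ⟨0, by rintro _ ⟨t, rfl⟩; exact norm_nonneg _⟩ 0).trans
      (MeasureTheory.norm_charFun_le_one 0)
  have hr0 : 0 < cs / cd := div_pos hcs hcd
  have hr1 : cs / cd < 1 := by
    rw [div_lt_one hcd]
    nlinarith
  have hmono := RationalInfDiv.acMass_convPow_mono Fs
  have hlt : ∀ k < n, RationalInfDiv.acMass (RationalInfDiv.convPow Fs k) = 0 := fun k hk =>
    le_antisymm ((hmono (Nat.le_sub_one_of_lt hk)).trans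
      (RationalInfDiv.acMass_eq_zero hsing.2).le) (RationalInfDiv.acMass_nonneg _)
  have hαβ : α ≤ RationalInfDiv.acMass (RationalInfDiv.convPow Fs n) := by
    have h1 := RationalInfDiv.real_univ_le_acMass (μ := RationalInfDiv.convPow Fs n)
      (hHa_ac.smul_left (ENNReal.ofReal α)) (by
        rw [hmix]
        exact MeasureTheory.Measure.le_add_right le_rfl)
    simpa [MeasureTheory.measureReal_ennreal_smul_apply, ENNReal.toReal_ofReal hα0.le] using h1
  have main : (n : ℝ) / ((n : ℝ) + 1) * (cs / cd) ≤ α → ¬ RationalInfDiv.IsContSingularFun W :=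
    fun hα hW => RationalInfDiv.not_hasSum_alternating (by omega) hr0 hr1 hmono
      (fun k => RationalInfDiv.acMass_le_one _) hlt hαβ hα
      (hrep.hasSum_acMass hdec hcd hcs hμ0 hμ hW)
  refine ⟨main, fun hα => main ?_⟩
  rw [hα]
  have h1 : (n : ℝ) / ((n : ℝ) + 1) ≤ 1 := (div_le_one (by positivity)).2 (by linarith)
  exact mul_le_one₀ h1 hr0.le hr1.le
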